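/- Let $n\in\mathbb N$, let $T\subset SU(n)$ be the maximal torus of diagonal matrices, let $p_k\colon T\to U(1)$ be the homomorphism sending $t$ to its $k$-th diagonal entry, and let $P_k\colon SU(n)/T\to M_n(\mathbb C)$ send $gT$ to the orthogonal projection of $\mathbb C^n$ onto the line spanned by $g e_k$; via $gT\mapsto(P_1,\dots,P_n)$ the manifold $SU(n)/T$ is identified with the manifold of $n$-tuples of orthogonal projections onto mutually orthogonal lines in $\mathbb C^n$. The functions $p_k$ and $P_k$ are also regarded as functions on $T\times SU(n)/T$ and on spaces over it. Let $Y=\{(z,g)\in (U(1)\setminus\{1\})\times SU(n) : z\notin\operatorname{spec}(g)\}\to SU(n)$ be the surjective submersion of the basic bundle gerbe, and for $z\in U(1)\setminus\{1\}$ let $\log_z$ be the branch of the logarithm cut along the ray from $0$ through $z$ with $\log_z(1)=0$. The curving of the basic bundle gerbe is the two-form on $Y$ given by holomorphic functional calculus as $$f_b\big|_{(z,g)}=\frac1{8\pi^2}\oint_{C}\log_z(\xi)\,\operatorname{tr}\!\left((\xi-g)^{-1}dg\,(\xi-g)^{-2}dg\right)d\xi ,$$ where $C$ is a contour in the complement of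 the ray that encircles $\operatorname{spec}(g)$ once anticlockwise (for example a sum of small circles about the eigenvalues). Let $p\colon T\times SU(n)/T\to SU(n)$, $p(t,gT)=gtg^{-1}$, be the Weyl map, let $p^{-1}(Y)=Y_T\times SU(n)/T$ with $Y_T=\{(z,t)\in (U(1)\setminus\{1\})\times T: z\neq p_k(t)\text{ for all }k\}$, let $\pi\colon Y_T\times SU(n)/T\to T\times SU(n)/T$ be the projection, and let $f_{p^*b}\in\Omega^2(Y_T\times SU(n)/T)$ be the pull-back of $f_b$ along $(z,t,gT)\mapsto (z,gtg^{-1})$, i.e. the curving of the pull-back of the basic bundle gerbe by the Weyl map. Its three-curvature $\omega_{p^*b}$ is the unique $\omega\in\Omega^3(T\times SU(n)/T)$ with $\pi^*\omega=df_{p^*b}$. Define $\beta\in\Omega^2(T\times SU(n)/T)$ by $$\beta=-\frac{i}{4\pi}\sum_{\substack{i,k=1\\ i\neq k}}^n p_ip_k^{-1}\operatorname{tr}(P_i\,dP_k\,dP_k).$$ Then $$f_{p^*b}=\sum_{k=1}^n\Big(\frac{-1}{2\pi i}\log_z p_k\Big)\operatorname{tr}(P_k\,dP_k\,dP_k)+\pi^*\beta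 ,$$ and the three-curvature exists, is unique, and equals $$\omega_{p^*b}=-\frac1{2\pi i}\sum_{k=1}^n p_k^{-1}dp_k\wedge\operatorname{tr}(P_k\,dP_k\,dP_k)+d\beta .$$ Moreover, if $\omega_b\in\Omega^3(SU(n))$ is the three-curvature of $f_b$, i.e. the pull-back of $\omega_b$ to $Y$ is $df_b$, then $p^*\omega_b$ is this same form. -/

import Mathlib

open Set
open scoped ContDiff

attribute [local instance] Matrix.normedAddCommGroup Matrix.normedSpace

namespace WeylGerbe

noncomputable section

/-! ### Differential forms on embedded submanifolds

The manifolds below are embedded submanifolds `S` of finite-dimensional real vector spaces `V`. -/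

section Forms

variable {V W : Type*} [NormedAddCommGroup V] [NormedSpace ℝ V]
  [NormedAddCommGroup W] [NormedSpace ℝ W]

/-- The tangent space of `S ⊆ V` at `x`: the span of the velocities at `x` of the smooth curves
that run in `S`. -/
def tangent (S : Set V) (x : V) : Submodule ℝ V :=
  Submodule.span ℝ {v | ∃ γ : ℝ → V, ContDiff ℝ ∞ γ ∧ (∀ s, γ s ∈ S) ∧ γ 0 = x ∧ deriv γ 0 = v}

/-- Complex-valued `k`-forms on `S` (no regularity yet): an alternating `k`-linear map on each
tangent space. They are added, and multiplied by functions, pointwise. -/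
abbrev DiffForm (S : Set V) (k : ℕ) : Type _ :=
  ∀ x : S, (tangent S x.1) [⋀^Fin k]→L[ℝ] ℂ

/-- Complex-valued covectors: the linear forms on the tangent space of `S` at `x`. -/
abbrev Covector (S : Set V) (x : S) : Type _ := tangent S x.1 →L[ℝ] ℂ

/-- A smooth map `S → S'`, given as the restriction of a smooth map of the ambient spaces. -/
structure SmoothMap (S : Set V) (S' : Set W) where
  toFun : V → W
  contDiff : ContDiff ℝ ∞ toFun
  mapsTo : ∀ x ∈ S, toFun x ∈ S'

namespace SmoothMap

variable {S : Set V} {S' : Set W}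

/-- The map on points. -/
def onPoint (F : SmoothMap S S') (x : S) : S' := ⟨F.toFun x.1, F.mapsTo x.1 x.2⟩

theorem fderiv_mem (F : SmoothMap S S') (x : V) {v : V} (hv : v ∈ tangent S x) :
    fderiv ℝ F.toFun x v ∈ tangent S' (F.toFun x) := by
  unfold tangent at hv
  induction hv using Submodule.span_induction with
  | mem v hv =>
    obtain ⟨γ, hγ, hS, h0, hd⟩ := hv
    refine Submodule.subset_span ⟨F.toFun ∘ γ, F.contDiff.comp hγ,
      fun s => F.mapsTo _ (hS s), by simp [h0], ?_⟩
    have h1 : DifferentiableAt ℝ F.toFun (γ 0) := F.contDiff.differentiable (by simp) _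
    have h2 : DifferentiableAt ℝ γ 0 := hγ.differentiable (by simp) _
    rw [fderiv_comp_deriv _ h1 h2, h0, hd]
  | zero => simp
  | add v w _ _ hv hw => rw [map_add]; exact Submodule.add_mem _ hv hw
  | smul c v _ hv => rw [map_smul]; exact Submodule.smul_mem _ c hv

/-- The tangent map. -/
def tangentMap (F : SmoothMap S S') (x : S) :
    tangent S x.1 →L[ℝ] tangent S' (F.onPoint x).1 :=
  ((fderiv ℝ F.toFun x.1).comp (tangent S x.1).subtypeL).codRestrict _
    fun v => F.fderiv_mem x.1 v.2

/-- Pull-back of forms. -/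
def pullback {k : ℕ} (F : SmoothMap S S') (α : DiffForm S' k) : DiffForm S k :=
  fun x => (α (F.onPoint x)).compContinuousLinearMap (F.tangentMap x)

end SmoothMap

/-- A smoothly parametrised piece of `S`: a smooth map `ℝᵐ → V` with values in `S`. The inverses
of the charts of a manifold `S` (with chart domains `ℝᵐ`) are among these. -/
structure Plot (S : Set V) (m : ℕ) where
  toFun : EuclideanSpace ℝ (Fin m) → V
  contDiff : ContDiff ℝ ∞ toFun
  mem : ∀ u, toFun u ∈ S

namespace Plot

variable {S : Set V} {m : ℕ}

theorem fderiv_mem (φ : Plot S m) (u e : EuclideanSpace ℝ (Fin m)) :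
    fderiv ℝ φ.toFun u e ∈ tangent S (φ.toFun u) := by
  refine Submodule.subset_span ⟨fun s : ℝ => φ.toFun (u + s • e),
    φ.contDiff.comp (by fun_prop), fun s => φ.mem _, by simp, ?_⟩
  have h1 : DifferentiableAt ℝ φ.toFun (u + (0 : ℝ) • e) := φ.contDiff.differentiable (by simp) _
  have h2 : HasDerivAt (fun s : ℝ => u + s • e) e 0 := by
    simpa using ((hasDerivAt_id (0 : ℝ)).smul_const e).const_add u
  have h3 := h1.hasFDerivAt.comp_hasDerivAt (0 : ℝ) h2
  simpa [Function.comp_def] using h3.deriv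

/-- The tangent map of a parametrisation. -/
def tangentMap (φ : Plot S m) (u : EuclideanSpace ℝ (Fin m)) :
    EuclideanSpace ℝ (Fin m) →L[ℝ] tangent S (φ.toFun u) :=
  (fderiv ℝ φ.toFun u).codRestrict _ fun e => φ.fderiv_mem u e

/-- A form on `S` written in the parameters `u ∈ ℝᵐ`. -/
def pullback {k : ℕ} (φ : Plot S m) (α : DiffForm S k) (u : EuclideanSpace ℝ (Fin m)) :
    (EuclideanSpace ℝ (Fin m)) [⋀^Fin k]→L[ℝ] ℂ :=
  (α ⟨φ.toFun u, φ.mem u⟩).compContinuousLinearMap (φ.tangentMap u)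

end Plot

/-- The form is smooth, i.e. it lies in `Ω^k(S)`: it is smooth in all parametrisations. -/
def IsSmoothForm {S : Set V} {k : ℕ} (α : DiffForm S k) : Prop :=
  ∀ (m : ℕ) (φ : Plot S m), ContDiff ℝ ∞ (φ.pullback α)

/-- `η = dα`: in all parametrisations `η` is the exterior derivative of `α`. -/
def IsExtDeriv {S : Set V} {k : ℕ} (α : DiffForm S k) (η : DiffForm S (k + 1)) : Prop :=
  ∀ (m : ℕ) (φ : Plot S m) (u : EuclideanSpace ℝ (Fin m)),
    extDeriv (φ.pullback α) u = φ.pullback η u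

/-- Let `π : Y → M` be the surjective submersion of a bundle gerbe with curving `f ∈ Ω²(Y)`.
The three-curvature of the curving is the form `α ∈ Ω³(M)` with
`π^* α = df`. -/
def IsThreeCurvature {Y : Set V} {M : Set W} (π : SmoothMap Y M) (f : DiffForm Y 2)
    (α : DiffForm M 3) : Prop :=
  IsSmoothForm α ∧ IsExtDeriv f (π.pullback α)

/-- The wedge product of a one-form and a `k`-form at a point,
`(α ∧ σ)(v₀, …, v_k) = ∑ⱼ (-1)ʲ α(vⱼ) σ(v₀, …, v̂ⱼ, …, v_k)`
(the convention that goes with `extDeriv`). -/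
def oneWedge {k : ℕ} (α : V →L[ℝ] ℂ) (σ : V [⋀^Fin k]→L[ℝ] ℂ) : V [⋀^Fin (k + 1)]→L[ℝ] ℂ :=
  .alternatizeUncurryFin (α.smulRight σ)

end Forms

/-! ### The spaces -/

/-- Complex `n × n` matrices. -/
abbrev Mat (n : ℕ) : Type := Matrix (Fin n) (Fin n) ℂ

/-- The group `SU(n)`, as a subset of the matrices. -/
def SU (n : ℕ) : Set (Mat n) := {g | g ∈ Matrix.specialUnitaryGroup (Fin n) ℂ}

/-- The maximal torus `T` of diagonal matrices in `SU(n)`. -/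
def torus (n : ℕ) : Set (Mat n) := {t | t ∈ SU n ∧ t.IsDiag}

/-- The manifold `Proj_n ≅ SU(n)/T` of the `n`-tuples `(P₁, …, P_n)` of orthogonal projections
onto mutually orthogonal one-dimensional subspaces of `ℂⁿ`. The coset `gT` corresponds to the
tuple of the projections `g E_{ii} g*` onto the lines spanned by `g eᵢ`. -/
def projTuples (n : ℕ) : Set (Fin n → Mat n) :=
  {P | (∀ i, (P i).IsHermitian ∧ P i * P i = P i ∧ (P i).rank = 1) ∧
    ∀ i j, i ≠ j → P i * P j = 0}

/-- `T × SU(n)/T`. -/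
def base (n : ℕ) : Set (Mat n × (Fin n → Mat n)) := torus n ×ˢ projTuples n

/-- The space `Y` of the basic bundle gerbe: the pairs `(z, g)` with `z ∈ U(1) ∖ {1}`,
`g ∈ SU(n)` and `z ∉ spec(g)`. -/
def basicY (n : ℕ) : Set (ℂ × Mat n) :=
  {y | (‖y.1‖ = 1 ∧ y.1 ≠ 1) ∧ y.2 ∈ SU n ∧ y.1 ∉ spectrum ℂ y.2}

/-- The Weyl map `T × SU(n)/T → SU(n)`, `(t, gT) ↦ g t g⁻¹`, which under
`SU(n)/T ≅ Proj_n` reads `(t, P) ↦ ∑ᵢ pᵢ(t) Pᵢ`. -/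
def weylMap {n : ℕ} (x : Mat n × (Fin n → Mat n)) : Mat n := ∑ i, x.1 i i • x.2 i

/-- The tuple of projections that corresponds to the coset `gT`. -/
def cosetProj {n : ℕ} (g : Mat n) (i : Fin n) : Mat n := g * Matrix.single i i 1 * star g

theorem weylMap_cosetProj {n : ℕ} (g t : Mat n) (ht : t.IsDiag) :
    weylMap (t, cosetProj g) = g * t * star g := by
  have h : t = ∑ i, t i i • Matrix.single i i (1 : ℂ) := by
    ext a b
    rw [Matrix.sum_apply]
    by_cases hab : a = b
    · subst hab
      simp [Matrix.single_apply]
    · rw [ht hab]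
      symm
      refine Finset.sum_eq_zero fun i _ => ?_
      have : ¬ (i = a ∧ i = b) := fun h => hab (h.1.symm.trans h.2)
      simp [this]
  conv_rhs => rw [h]
  simp only [weylMap, cosetProj, Finset.mul_sum, Finset.sum_mul, Matrix.mul_smul, Matrix.smul_mul]

theorem exists_unit_vector {n : ℕ} {P : Mat n} (h1 : P.IsHermitian) (h2 : P * P = P)
    (h3 : P.rank = 1) :
    ∃ u : Fin n → ℂ, P = Matrix.vecMulVec u (star u) ∧ star u ⬝ᵥ u = 1 := by
  obtain ⟨⟨w, x, hx⟩, hw0, hw⟩ := finrank_eq_one_iff'.1 h3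
  have hx' : P.mulVec x = w := hx
  have hPw : P.mulVec w = w := by rw [← hx', Matrix.mulVec_mulVec, h2]
  have hw0' : w ≠ 0 := fun h => hw0 (Subtype.ext h)
  have hs : ∀ y, star w ⬝ᵥ P.mulVec y = star w ⬝ᵥ y := by
    intro y
    rw [Matrix.dotProduct_mulVec]
    congr 1
    conv_rhs => rw [← hPw, Matrix.star_mulVec, h1.eq]
  obtain ⟨r, hr0, hr⟩ : ∃ r : ℝ, 0 < r ∧ star w ⬝ᵥ w = r := by
    obtain ⟨a, ha⟩ := Function.ne_iff.1 hw0'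
    refine ⟨∑ i, Complex.normSq (w i), Finset.sum_pos' (fun i _ => Complex.normSq_nonneg _)
      ⟨a, Finset.mem_univ _, Complex.normSq_pos.2 ha⟩, ?_⟩
    simp [dotProduct, Complex.normSq_eq_conj_mul_self]
  have hs2 : ((Real.sqrt r : ℝ) : ℂ)⁻¹ * ((Real.sqrt r : ℝ) : ℂ)⁻¹ = (r : ℂ)⁻¹ := by
    rw [← mul_inv, ← Complex.ofReal_mul, Real.mul_self_sqrt hr0.le]
  have hrc : (r : ℂ) ≠ 0 := by exact_mod_cast hr0.ne'
  have hst : star (((Real.sqrt r : ℝ) : ℂ)⁻¹) = ((Real.sqrt r : ℝ) : ℂ)⁻¹ := by simp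
  refine ⟨((Real.sqrt r : ℝ) : ℂ)⁻¹ • w, ?_, ?_⟩
  · refine Matrix.ext_of_mulVec_single fun j => ?_
    obtain ⟨c, hc⟩ := hw ⟨P.mulVec (Pi.single j 1), _, rfl⟩
    have hc' : c • w = P.mulVec (Pi.single j 1) := congrArg Subtype.val hc
    have h5 := hs (Pi.single j 1)
    rw [← hc', dotProduct_smul, hr, smul_eq_mul] at h5
    rw [← hc', Matrix.vecMulVec_mulVec, star_smul, hst, smul_dotProduct, ← h5]
    ext a
    simp only [Pi.smul_apply, smul_eq_mul, MulOpposite.smul_eq_mul_unop, MulOpposite.unop_op]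
    linear_combination (-c * w a * r) * hs2 + (-c * w a) * (inv_mul_cancel₀ hrc)
  · rw [star_smul, hst, smul_dotProduct, dotProduct_smul, hr, smul_eq_mul, smul_eq_mul,
      ← mul_assoc, hs2, inv_mul_cancel₀ hrc]

theorem cosetProj_mul_diagonal {n : ℕ} (g : Mat n) (c : Fin n → ℂ) (hc : ∀ i, c i * star (c i) = 1) :
    cosetProj (g * Matrix.diagonal c) = cosetProj g := by
  funext i
  have h : Matrix.diagonal c * Matrix.single i i 1 * star (Matrix.diagonal c) =
      Matrix.single i i 1 := by
    rw [Matrix.star_eq_conjTranspose, Matrix.diagonal_conjTranspose]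
    ext a b
    rw [Matrix.mul_diagonal, Matrix.diagonal_mul]
    by_cases hab : i = a ∧ i = b
    · obtain ⟨rfl, rfl⟩ := hab
      simpa using hc i
    · simp [hab]
  calc _ = g * (Matrix.diagonal c * Matrix.single i i 1 * star (Matrix.diagonal c)) * star g := by
        simp only [cosetProj, star_mul, mul_assoc]
    _ = _ := by rw [h]; rfl

/-- `g ↦ cosetProj g` maps `SU(n)` onto `Proj_n`. -/
theorem mem_projTuples_iff {n : ℕ} (P : Fin n → Mat n) :
    P ∈ projTuples n ↔ ∃ g ∈ SU n, cosetProj g = P := by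
  constructor
  · rintro ⟨h1, h2⟩
    choose u hu hn using fun i => exists_unit_vector (h1 i).1 (h1 i).2.1 (h1 i).2.2
    have ho : ∀ i j, i ≠ j → star (u i) ⬝ᵥ u j = 0 := by
      intro i j hij
      have h := congrArg (fun A : Mat n => star (u i) ⬝ᵥ A.mulVec (u j)) (h2 i j hij)
      rw [hu i, hu j] at h
      simpa [← Matrix.mulVec_mulVec, Matrix.vecMulVec_mulVec, hn] using h
    set U : Mat n := Matrix.of fun a i => u i a with hU
    have hUU : star U * U = 1 := by
      ext i j
      have : (star U * U) i j = star (u i) ⬝ᵥ u j := rfl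
      rw [this]
      by_cases hij : i = j
      · subst hij; simp [hn]
      · simp [ho i j hij, hij]
    have hcU : cosetProj U = P := by
      funext i
      rw [hu i]
      ext a b
      simp [cosetProj, Matrix.mul_apply, Matrix.single_apply, hU, Matrix.vecMulVec_apply,
        Matrix.star_apply, Finset.sum_ite_eq, ite_and]
    have hdet : star U.det * U.det = 1 := by
      have := congrArg Matrix.det hUU
      rwa [Matrix.det_mul, Matrix.star_eq_conjTranspose, Matrix.det_conjTranspose,
        Matrix.det_one] at this
    cases n with
    | zero => exact ⟨1, (Matrix.specialUnitaryGroup (Fin 0) ℂ).one_mem, Subsingleton.elim _ _⟩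
    | succ n =>
      set c : Fin (n + 1) → ℂ := Function.update 1 0 (star U.det) with hc
      have hcc : ∀ i, c i * star (c i) = 1 := by
        intro i
        by_cases hi : i = 0
        · subst hi; simpa [hc] using hdet
        · simp [hc, hi]
      refine ⟨U * Matrix.diagonal c, ⟨?_, ?_⟩, by rw [cosetProj_mul_diagonal U c hcc, hcU]⟩
      · refine Submonoid.mul_mem _ (Matrix.mem_unitaryGroup_iff'.2 hUU)
          (Matrix.mem_unitaryGroup_iff.2 ?_)
        rw [Matrix.star_eq_conjTranspose, Matrix.diagonal_conjTranspose,
          Matrix.diagonal_mul_diagonal, ← Matrix.diagonal_one]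
        congr 1
        funext i
        exact hcc i
      · change (U * Matrix.diagonal c).det = 1
        rw [Matrix.det_mul, Matrix.det_diagonal, hc, Finset.prod_update_of_mem (Finset.mem_univ _)]
        simpa [mul_comm] using hdet
  · rintro ⟨g, ⟨hg, -⟩, rfl⟩
    have hg' : star g * g = 1 := hg.1
    have hmul : ∀ i j, cosetProj g i * cosetProj g j =
        g * (Matrix.single i i 1 * Matrix.single j j 1) * star g := by
      intro i j
      calc _ = g * Matrix.single i i 1 * (star g * g) * Matrix.single j j 1 * star g := by
            simp only [cosetProj, mul_assoc]
        _ = _ := by rw [hg']; simp only [mul_one, mul_assoc]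
    refine ⟨fun i => ⟨?_, ?_, ?_⟩, fun i j hij => ?_⟩
    · simp [Matrix.IsHermitian, cosetProj, Matrix.star_eq_conjTranspose, mul_assoc]
    · rw [hmul]; simp [cosetProj]
    · have hu1 : IsUnit g.det := (Matrix.isUnit_iff_isUnit_det g).1 (IsUnit.of_mul_eq_one_right _ hg')
      have hu2 : IsUnit (star g).det :=
        (Matrix.isUnit_iff_isUnit_det _).1 (IsUnit.of_mul_eq_one _ hg')
      rw [cosetProj, Matrix.rank_mul_eq_left_of_isUnit_det _ _ hu2,
        Matrix.rank_mul_eq_right_of_isUnit_det _ _ hu1]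
      have : Matrix.single i i (1 : ℂ) = Matrix.diagonal (Pi.single i 1) := by
        rw [Matrix.diagonal_single]
      rw [this, Matrix.rank_diagonal]
      simp [Pi.single_apply]
    · rw [hmul, Matrix.single_mul_single_of_ne _ _ _ _ hij]
      simp

/-- The fibres of `g ↦ cosetProj g` are the cosets of `T`. -/
theorem cosetProj_eq_iff {n : ℕ} {g h : Mat n} (hg : g ∈ SU n) (hh : h ∈ SU n) :
    cosetProj g = cosetProj h ↔ star g * h ∈ torus n := by
  have hg1 : star g * g = 1 := hg.1.1
  have hg2 : g * star g = 1 := hg.1.2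
  have hh1 : star h * h = 1 := hh.1.1
  have hSU : star g * h ∈ SU n :=
    Submonoid.mul_mem _ (star (⟨g, hg⟩ : Matrix.specialUnitaryGroup (Fin n) ℂ)).2 hh
  have key : g * (star g * h) = h := by rw [← mul_assoc, hg2, one_mul]
  constructor
  · intro he
    refine ⟨hSU, fun a b hab => ?_⟩
    have h1 : Matrix.single a a 1 * (star g * h) = (star g * h) * Matrix.single a a 1 := by
      have h2 := congrFun he a
      simp only [cosetProj] at h2
      calc _ = star g * g * Matrix.single a a 1 * star g * h := by
            rw [hg1, one_mul, mul_assoc]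
        _ = star g * (g * Matrix.single a a 1 * star g) * h := by simp only [mul_assoc]
        _ = star g * h * Matrix.single a a 1 * (star h * h) := by rw [h2]; simp only [mul_assoc]
        _ = _ := by rw [hh1, mul_one]
    have h3 := congrFun (congrFun h1 a) b
    rw [Matrix.mul_single_apply_of_ne (hbj := Ne.symm hab)] at h3
    simpa using h3
  · rintro ⟨⟨hu, -⟩, hd⟩
    obtain ⟨c, hc⟩ : ∃ c, Matrix.diagonal c = star g * h := ⟨_, hd.diagonal_diag⟩
    rw [← key, ← hc, cosetProj_mul_diagonal]
    intro i
    have h4 := hu.2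
    rw [← hc, Matrix.star_eq_conjTranspose, Matrix.diagonal_conjTranspose,
      Matrix.diagonal_mul_diagonal] at h4
    simpa using congrFun (congrFun h4 i) i

theorem weylMap_mem {n : ℕ} {x : Mat n × (Fin n → Mat n)} (hx : x ∈ base n) :
    weylMap x ∈ SU n := by
  obtain ⟨t, P⟩ := x
  obtain ⟨g, hg, rfl⟩ := (mem_projTuples_iff P).1 hx.2
  rw [weylMap_cosetProj g t hx.1.2]
  exact Submonoid.mul_mem _ (Submonoid.mul_mem _ hg hx.1.1)
    (star (⟨g, hg⟩ : Matrix.specialUnitaryGroup (Fin n) ℂ)).2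

theorem spectrum_weylMap {n : ℕ} {x : Mat n × (Fin n → Mat n)} (hx : x ∈ base n) :
    spectrum ℂ (weylMap x) = Set.range fun i => x.1 i i := by
  obtain ⟨t, P⟩ := x
  obtain ⟨g, hg, rfl⟩ := (mem_projTuples_iff P).1 hx.2
  have hd : Matrix.diagonal t.diag = t := hx.1.2.diagonal_diag
  rw [weylMap_cosetProj g t hx.1.2]
  have h := spectrum.units_conjugate (R := ℂ) (a := t) (u := ⟨g, star g, hg.1.2, hg.1.1⟩)
  refine h.trans ?_
  conv_lhs => rw [← hd, spectrum_diagonal]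
  rfl

theorem contDiff_weylMap (n : ℕ) : ContDiff ℝ ∞ (weylMap (n := n)) := by
  unfold weylMap
  refine ContDiff.sum fun i _ => ?_
  have h1 : ContDiff ℝ ∞ fun x : Mat n × (Fin n → Mat n) => x.1 i i := by
    have : ContDiff ℝ ∞ fun x : Mat n × (Fin n → Mat n) => (x.1 : Fin n → Fin n → ℂ) :=
      contDiff_fst
    exact contDiff_pi.1 (contDiff_pi.1 this i) i
  have h2 : ContDiff ℝ ∞ fun x : Mat n × (Fin n → Mat n) => x.2 i :=
    contDiff_pi.1 contDiff_snd i
  exact ContDiff.smul h1 h2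

/-- The Weyl map as a smooth map `T × SU(n)/T → SU(n)`. -/
def weyl (n : ℕ) : SmoothMap (base n) (SU n) where
  toFun := weylMap
  contDiff := contDiff_weylMap n
  mapsTo _ hx := weylMap_mem hx

/-- The surjective submersion `Y → SU(n)` of the basic bundle gerbe. -/
def basicProj (n : ℕ) : SmoothMap (basicY n) (SU n) where
  toFun y := y.2
  contDiff := contDiff_snd
  mapsTo _ hy := hy.2.1

/-- `Y_T × SU(n)/T`: the triples `(z, t, P)` with `(t, P) ∈ T × SU(n)/T`, `z ∈ U(1) ∖ {1}` and
`z ≠ tᵢ` for all `i`. -/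
def weylY (n : ℕ) : Set (ℂ × (Mat n × (Fin n → Mat n))) :=
  {y | y.2 ∈ base n ∧ (‖y.1‖ = 1 ∧ y.1 ≠ 1) ∧ ∀ i, y.1 ≠ y.2.1 i i}

/-- `Y_T × SU(n)/T` is the pull-back `p⁻¹(Y)` of `Y → SU(n)` by the Weyl map `p`. -/
theorem mem_weylY_iff {n : ℕ} (y : ℂ × (Mat n × (Fin n → Mat n))) :
    y ∈ weylY n ↔ y.2 ∈ base n ∧ (y.1, weylMap y.2) ∈ basicY n := by
  refine and_congr_right fun hx => ?_
  simp only [basicY, mem_ofPred_eq, spectrum_weylMap hx, weylMap_mem hx, mem_range, not_exists,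
    true_and]
  exact and_congr_right fun _ => forall_congr' fun i => ne_comm

/-- The projection `Y_T × SU(n)/T → T × SU(n)/T`. -/
def projBase (n : ℕ) : SmoothMap (weylY n) (base n) where
  toFun y := y.2
  contDiff := contDiff_snd
  mapsTo _ hy := hy.1

/-- The map `Y_T × SU(n)/T = p⁻¹(Y) → Y` that covers the Weyl map. -/
def weylLift (n : ℕ) : SmoothMap (weylY n) (basicY n) where
  toFun y := (y.1, weylMap y.2)
  contDiff := contDiff_fst.prodMk ((contDiff_weylMap n).comp contDiff_snd)
  mapsTo y hy := ((mem_weylY_iff y).1 hy).2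

/-! ### The forms -/

/-- For matrices `A`, `B` and matrix-valued one-forms `θ`, `η` on a vector space, the two-form
`tr(A θ B η)`, i.e. `(v, w) ↦ tr(A θ(v) B η(w)) - tr(A θ(w) B η(v))`. -/
def traceForm {n : ℕ} {E : Type*} [NormedAddCommGroup E] [NormedSpace ℝ E]
    [FiniteDimensional ℝ E] (A : Mat n) (θ : E →ₗ[ℝ] Mat n) (B : Mat n) (η : E →ₗ[ℝ] Mat n) :
    E [⋀^Fin 2]→L[ℝ] ℂ where
  toFun v := (A * θ (v 0) * B * η (v 1)).trace - (A * θ (v 1) * B * η (v 0)).trace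
  map_update_add' := by
    intro _ v i x y
    fin_cases i <;> simp [mul_add, add_mul] <;> ring
  map_update_smul' := by
    intro _ v i c x
    fin_cases i <;> simp [mul_sub]
  map_eq_zero_of_eq' := by
    intro v i j hv hij
    fin_cases i <;> fin_cases j <;> simp_all
  cont := by
    have hc (i : Fin 2) : Continuous fun v : Fin 2 → E => v i := continuous_apply i
    have hθ (i : Fin 2) := θ.continuous_of_finiteDimensional.comp (hc i)
    have hη (i : Fin 2) := η.continuous_of_finiteDimensional.comp (hc i)
    exact ((((continuous_const.matrix_mul (hθ 0)).matrix_mul continuous_const).matrix_mul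
      (hη 1)).matrix_trace).sub ((((continuous_const.matrix_mul (hθ 1)).matrix_mul
      continuous_const).matrix_mul (hη 0)).matrix_trace)

theorem traceForm_apply {n : ℕ} {E : Type*} [NormedAddCommGroup E] [NormedSpace ℝ E]
    [FiniteDimensional ℝ E] (A : Mat n) (θ : E →ₗ[ℝ] Mat n) (B : Mat n) (η : E →ₗ[ℝ] Mat n)
    (v : Fin 2 → E) :
    traceForm A θ B η v =
      (A * θ (v 0) * B * η (v 1)).trace - (A * θ (v 1) * B * η (v 0)).trace := rfl

/-- The branch `log_z` of the logarithm, for `z ≠ 0` not a positive real, that is cut along the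
ray from `0` through `z` and satisfies `log_z(1) = 0`. -/
def logBranch (z ξ : ℂ) : ℂ := Complex.log (-ξ / z) - Complex.log (-1 / z)

/-- The closed ray from `0` through `z`. -/
def ray (z : ℂ) : Set ℂ := {ξ | ∃ r : ℝ, 0 ≤ r ∧ ξ = r * z}

/-- A radius `r > 0` such that the closed disc of radius `r` about the eigenvalue `lam` of `g`
meets neither the ray through `z` nor the rest of the spectrum of `g`; the discs about different
eigenvalues are disjoint. -/
def contourRadius {n : ℕ} (z : ℂ) (g : Mat n) (lam : ℂ) : ℝ :=
  Metric.infDist lam (ray z ∪ (spectrum ℂ g \ {lam})) / 3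

/-- The curving of the basic bundle gerbe, the two-form on `Y` given by holomorphic functional
calculus as
`f_b = (1 / 8π²) ∮_C log_z(ξ) tr((ξ - g)⁻¹ dg (ξ - g)⁻² dg) dξ`,
where the contour `C` lies in `ℂ` without the ray through `z` and runs around the spectrum of `g`
once, anticlockwise. Up to homology in the domain of the integrand, `C` is the sum of small
circles about the eigenvalues of `g`. -/
def basicCurving (n : ℕ) : DiffForm (basicY n) 2 := fun y =>
  let z := y.1.1
  let g := y.1.2
  let dg : tangent (basicY n) y.1 →ₗ[ℝ] Mat n :=
    LinearMap.snd ℝ ℂ (Mat n) ∘ₗ (tangent (basicY n) y.1).subtype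
  (1 / (8 * (Real.pi : ℂ) ^ 2)) •
    ∑ lam ∈ g.charpoly.roots.toFinset,
      ∮ ξ in C(lam, contourRadius z g lam),
        logBranch z ξ • traceForm (ξ • (1 : Mat n) - g)⁻¹ dg ((ξ • (1 : Mat n) - g)⁻¹ ^ 2) dg

/-- The curving `f_{p^*b}` of the pull-back of the basic bundle gerbe by the Weyl map: the
pull-back of the curving of the basic bundle gerbe to `p⁻¹(Y)`. -/
def pulledCurving (n : ℕ) : DiffForm (weylY n) 2 := (weylLift n).pullback (basicCurving n)

/-- The homomorphism `p_k : T → U(1)`, `t ↦ t_k`, as a function on `T × SU(n)/T`. -/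
def p {n : ℕ} (k : Fin n) (x : base n) : ℂ := x.1.1 k k

/-- The one-form `dp_k` on `T × SU(n)/T`. -/
def dp {n : ℕ} (k : Fin n) (x : base n) : Covector (base n) x :=
  LinearMap.toContinuousLinearMap (Matrix.entryLinearMap ℝ ℂ k k ∘ₗ
    LinearMap.fst ℝ (Mat n) (Fin n → Mat n) ∘ₗ (tangent (base n) x.1).subtype)

/-- The matrix-valued one-form `dP_k` on `T × SU(n)/T`. -/
def dP {n : ℕ} (k : Fin n) (x : base n) : tangent (base n) x.1 →ₗ[ℝ] Mat n :=
  LinearMap.proj k ∘ₗ LinearMap.snd ℝ (Mat n) (Fin n → Mat n) ∘ₗ (tangent (base n) x.1).subtype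

/-- The two-form `tr(P_i dP_k dP_k)` on `T × SU(n)/T`. -/
def trPdPdP {n : ℕ} (i k : Fin n) : DiffForm (base n) 2 := fun x =>
  traceForm (x.1.2 i) (dP k x) 1 (dP k x)

/-- `β = -(i/4π) ∑_{i ≠ k} p_i p_k⁻¹ tr(P_i dP_k dP_k)`, a two-form on `T × SU(n)/T`. -/
def beta (n : ℕ) : DiffForm (base n) 2 := fun x =>
  (-(Complex.I / (4 * Real.pi))) •
    ∑ i, ∑ k ∈ Finset.univ.erase i, (p i x * (p k x)⁻¹) • trPdPdP i k x

end

end WeylGerbe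

open WeylGerbe

/-! On the image of the Weyl map `g = ∑ a_k P_k`, where the `P_k` resolve the identity, so the
resolvent is `∑ (ξ - a_k)⁻¹ P_k` and the curving becomes a double sum of scalar contour integrals
times `tr(P_i dg P_j dg)`. Differentiating the relations `P_i P_j = δ_ij P_i` gives `P_i dg P_j =
(a_j - a_i) P_i dP_j` for `i ≠ j`, hence `tr(P_i dg P_j dg) = (a_j - a_i)² tr(P_i dP_j dP_j)`
(`IsResolution.trace_weyl`); the terms with `i = j` vanish by cyclicity. The square cancels the
denominators in the residues, leaving the coefficient `2πi (log a_i - log a_j + 1 - a_i/a_j)`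
(`sum_circleIntegral_logBranch`). The forms `c_ij = tr(P_i dP_j dP_j)` are antisymmetric off the
diagonal and have zero column sums. So the logarithms collapse to `2 ∑ log a_k c_kk`, the constant
`1` drops out, and the ratios make up `β` (`sum_antisymm_coefficients`, `pulledCurving_eq`).

For the three-curvature, all forms are extended to the ambient vector space and differentiated
there. The branch `log_z ξ` is locally constant in `z`, so `d log_z p_k = p_k⁻¹ dp_k`; and `d tr(P_k
dP_k dP_k) = tr(dP_k dP_k dP_k)` vanishes because `dP_k` is odd with respect to `P_k`. No `z` is
left, so the derivative descends (`isExtDeriv_pulledCurving`).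

Uniqueness needs enough parametrisations: `exists_plot_base` realises any tangent vectors as partial
derivatives at a point, and keeping `z` constant lifts such a parametrisation, after shrinking, to
`Y_T × SU(n)/T`. The claim about `p^*ω_b` then follows from uniqueness and the commuting square of
the Weyl map and its lift. -/

namespace WeylGerbe

noncomputable section

/-! ### Forms on a submanifold as restrictions of forms on the ambient space -/

section Ambient

variable {V W : Type*} [NormedAddCommGroup V] [NormedSpace ℝ V]
  [NormedAddCommGroup W] [NormedSpace ℝ W]

/-- A family of alternating maps on a finite-dimensional space is smooth if all its values are. -/
theorem contDiffAt_alternating [FiniteDimensional ℝ V] {k : ℕ} {f : W → V [⋀^Fin k]→L[ℝ] ℂ} {x : W}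
    (h : ∀ v, ContDiffAt ℝ ∞ (fun u => f u v) x) : ContDiffAt ℝ ∞ f x := by
  let b := Module.finBasis ℝ V
  let ev : (V [⋀^Fin k]→L[ℝ] ℂ) →ₗ[ℝ] ((Fin k → Fin (Module.finrank ℝ V)) → ℂ) :=
    { toFun := fun α σ => α fun i => b (σ i)
      map_add' := fun _ _ => rfl
      map_smul' := fun _ _ => rfl }
  have hev : LinearMap.ker ev = ⊥ := by
    refine LinearMap.ker_eq_bot.2 fun α β hαβ => ?_
    refine ContinuousAlternatingMap.toAlternatingMap_injective ?_
    refine Module.Basis.ext_alternating b fun σ _ => congrFun hαβ σ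
  -- A linear left inverse of evaluation on basis vectors recovers the family from finitely many
  -- smooth scalar functions.
  obtain ⟨g, hg⟩ := ev.exists_leftInverse_of_injective hev
  have hfg : f = (LinearMap.toContinuousLinearMap g) ∘ fun u => ev (f u) := by
    funext u
    exact (LinearMap.congr_fun hg (f u)).symm
  rw [hfg]
  exact (ContinuousLinearMap.contDiff _).contDiffAt.comp x (contDiffAt_pi.2 fun σ => h _)

/-- The restriction to `S` of a form on the ambient space. -/
def restrictForm (S : Set V) {k : ℕ} (A : V → V [⋀^Fin k]→L[ℝ] ℂ) : DiffForm S k :=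
  fun x => (A x.1).compContinuousLinearMap (tangent S x.1).subtypeL

variable {S : Set V} {k : ℕ} {A : V → V [⋀^Fin k]→L[ℝ] ℂ}

theorem ContDiffAt.alternating_apply {f : W → V [⋀^Fin k]→L[ℝ] ℂ} {g : W → Fin k → V} {x : W}
    (hf : ContDiffAt ℝ ∞ f x) (hg : ContDiffAt ℝ ∞ g x) :
    ContDiffAt ℝ ∞ (fun u => f u (g u)) x := by
  have h := ((ContinuousAlternatingMap.toContinuousMultilinearMapCLM (𝕜 := ℝ) (E := V) (ι := Fin k)
      (F := ℂ) ℝ).analyticAt_uncurry_of_multilinear (x := (f x, g x))).contDiffAt (n := ∞)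
  exact ContDiffAt.comp x h (hf.prodMk hg)

theorem isSmoothForm_restrictForm (hA : ∀ x ∈ S, ContDiffAt ℝ ∞ A x) :
    IsSmoothForm (restrictForm S A) := by
  intro m φ
  refine contDiff_iff_contDiffAt.2 fun u => contDiffAt_alternating fun v => ?_
  have h1 : ContDiffAt ℝ ∞ (fun u => A (φ.toFun u)) u :=
    (hA _ (φ.mem u)).comp u φ.contDiff.contDiffAt
  have h2 : ContDiffAt ℝ ∞ (fun u => fderiv ℝ φ.toFun u) u :=
    (φ.contDiff.fderiv_right (m := ∞) (by simp)).contDiffAt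
  exact ContDiffAt.alternating_apply (g := fun u i => fderiv ℝ φ.toFun u (v i)) h1
    (contDiffAt_pi.2 fun i => h2.clm_apply contDiffAt_const)

/-- The exterior derivative commutes with pull-back along a parametrisation, so it may be computed
with any extension that is smooth at the points of `S`. -/
theorem isExtDeriv_restrictForm (hA : ∀ x ∈ S, ContDiffAt ℝ ∞ A x) :
    IsExtDeriv (restrictForm S A) (restrictForm S (extDeriv A)) := by
  intro m φ u
  exact extDeriv_pullback ((hA _ (φ.mem u)).differentiableAt (by simp))
    (φ.contDiff.contDiffAt (n := ∞)) (by
      simp only [minSmoothness_of_isRCLikeNormedField]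
      exact WithTop.coe_le_coe.2 le_top)

theorem contDiffAt_extDeriv {x : V} (hA : ContDiffAt ℝ ∞ A x) : ContDiffAt ℝ ∞ (extDeriv A) x := by
  have h := ContinuousLinearMap.contDiff (𝕜 := ℝ) (E := V →L[ℝ] V [⋀^Fin k]→L[ℝ] ℂ)
    (F := V [⋀^Fin (k + 1)]→L[ℝ] ℂ) (n := ∞)
    (ContinuousAlternatingMap.alternatizeUncurryFinCLM (n := k) ℝ V ℂ)
  exact ContDiffAt.comp x h.contDiffAt (hA.fderiv_right (m := ∞) (by simp))

/-- Derivatives of equations for `S` vanish on tangent vectors. -/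
theorem hasFDerivAt_tangent_eq_zero {F : V → W} {F' : V →L[ℝ] W} {x : V} {c : W}
    (hF : HasFDerivAt F F' x) (hc : ∀ y ∈ S, F y = c) {v : V} (hv : v ∈ tangent S x) :
    F' v = 0 := by
  unfold tangent at hv
  induction hv using Submodule.span_induction with
  | mem v hv =>
    obtain ⟨γ, hγ, hS, h0, hd⟩ := hv
    subst h0
    have h2 : HasDerivAt γ v 0 := hd ▸ (hγ.differentiable (by simp) _).hasDerivAt
    have h3 := hF.comp_hasDerivAt (0 : ℝ) h2
    have h4 : F ∘ γ = fun _ => c := funext fun s => hc _ (hS s)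
    rw [h4] at h3
    exact h3.unique (hasDerivAt_const _ _)
  | zero => simp
  | add v w _ _ hv hw => rw [map_add, hv, hw, add_zero]
  | smul a v _ hv => rw [map_smul, hv, smul_zero]

end Ambient

/-! ### Residues of the branch of the logarithm -/

section Contour

open Metric

theorem isClosed_ray (z : ℂ) : IsClosed (ray z) := by
  by_cases hz : z = 0
  · have : ray z = {0} := by
      ext ξ
      simp only [ray, hz, mul_zero, mem_ofPred_eq, mem_singleton_iff]
      exact ⟨fun ⟨_, _, h⟩ => h, fun h => ⟨0, le_rfl, h⟩⟩
    rw [this]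
    exact isClosed_singleton
  · have : ray z = (fun ξ : ℂ => ξ / z) ⁻¹' ({w | 0 ≤ w.re} ∩ {w | w.im = 0}) := by
      ext ξ
      simp only [ray, mem_ofPred_eq, mem_preimage, mem_inter_iff]
      constructor
      · rintro ⟨r, hr, rfl⟩
        simp [mul_div_cancel_right₀ _ hz, hr]
      · rintro ⟨h1, h2⟩
        refine ⟨(ξ / z).re, h1, ?_⟩
        have : (((ξ / z).re : ℝ) : ℂ) = ξ / z := Complex.ext rfl (by simp [h2])
        rw [this, div_mul_cancel₀ _ hz]
    rw [this]
    exact ((isClosed_le continuous_const Complex.continuous_re).inter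
      (isClosed_eq Complex.continuous_im continuous_const)).preimage (by fun_prop)

theorem zero_mem_ray (z : ℂ) : 0 ∈ ray z := ⟨0, le_rfl, by simp⟩

theorem notMem_ray_of_norm_eq {z ξ : ℂ} (hz : ‖z‖ = 1) (hξ : ‖ξ‖ = 1) (h : z ≠ ξ) : ξ ∉ ray z := by
  rintro ⟨r, hr, rfl⟩
  rw [norm_mul, hz, mul_one, Complex.norm_real, Real.norm_of_nonneg hr] at hξ
  simp [hξ] at h

/-- The map `ξ ↦ -ξ/z` carries the ray through `z` to the cut of the principal logarithm. -/
theorem neg_div_mem_slitPlane {z ξ : ℂ} (hz : z ≠ 0) (hξ : ξ ∉ ray z) :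
    -ξ / z ∈ Complex.slitPlane := by
  rw [Complex.mem_slitPlane_iff]
  by_contra! h
  rw [neg_div, Complex.neg_re, Complex.neg_im] at h
  refine hξ ⟨(ξ / z).re, by linarith [h.1], ?_⟩
  have : (((ξ / z).re : ℝ) : ℂ) = ξ / z := Complex.ext rfl (by simpa [eq_comm] using h.2)
  rw [this, div_mul_cancel₀ _ hz]

theorem hasDerivAt_logBranch {z ξ : ℂ} (hz : z ≠ 0) (hξ : ξ ∉ ray z) :
    HasDerivAt (logBranch z) ξ⁻¹ ξ := by
  have hξ0 : ξ ≠ 0 := fun h => hξ (h ▸ zero_mem_ray z)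
  have h1 : HasDerivAt (fun ξ : ℂ => -ξ / z) (-1 / z) ξ :=
    ((hasDerivAt_id ξ).neg).div_const z
  have h2 := (h1.clog (neg_div_mem_slitPlane hz hξ)).sub_const (Complex.log (-1 / z))
  convert! h2 using 1
  field_simp

variable {z : ℂ} {s : Finset ℂ}

/-- The radius of the circle about `lam` in the contour around the finite set `s`. -/
def circleRadius (z : ℂ) (s : Finset ℂ) (lam : ℂ) : ℝ := infDist lam (ray z ∪ (↑s \ {lam})) / 3

theorem isClosed_ray_union (z : ℂ) (s : Finset ℂ) (lam : ℂ) : IsClosed (ray z ∪ (↑s \ {lam})) :=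
  (isClosed_ray z).union (s.finite_toSet.subset sdiff_subset).isClosed

theorem circleRadius_pos {lam : ℂ} (hlam : lam ∉ ray z) : 0 < circleRadius z s lam := by
  refine div_pos ?_ (by norm_num)
  refine ((isClosed_ray_union z s lam).notMem_iff_infDist_pos ⟨0, .inl (zero_mem_ray z)⟩).1 ?_
  simp [hlam]

theorem closedBall_circleRadius_subset {lam : ℂ} (hlam : lam ∉ ray z) :
    closedBall lam (circleRadius z s lam) ⊆ (ray z ∪ (↑s \ {lam}))ᶜ := by
  intro ξ hξ hmem
  have h1 := infDist_le_dist_of_mem (x := lam) hmem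
  have h2 := circleRadius_pos (s := s) hlam
  rw [mem_closedBall, dist_comm] at hξ
  unfold circleRadius at hξ h2
  linarith

theorem differentiableOn_logBranch (hz : z ≠ 0) (s : Finset ℂ) (lam : ℂ) :
    DifferentiableOn ℂ (logBranch z) (ray z ∪ (↑s \ {lam}))ᶜ := fun _ hξ =>
  (hasDerivAt_logBranch hz fun h => hξ (.inl h)).differentiableAt.differentiableWithinAt

theorem sub_ne_zero_of_mem_compl {lam a ξ : ℂ} (ha : a ∈ s) (hal : a ≠ lam)
    (hξ : ξ ∈ (ray z ∪ (↑s \ {lam}))ᶜ) : ξ - a ≠ 0 := fun h =>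
  hξ (.inr ⟨sub_eq_zero.1 h ▸ ha, by rwa [sub_eq_zero.1 h]⟩)

/-- The sum of the residues of `log_z(ξ) (ξ - a)⁻¹ (ξ - b)⁻²` at `a` and `b`. -/
theorem sum_circleIntegral_logBranch (hz : z ≠ 0) (hs : ∀ lam ∈ s, lam ∉ ray z) {a b : ℂ}
    (ha : a ∈ s) (hb : b ∈ s) (hab : a ≠ b) :
    ∑ lam ∈ s, (∮ ξ in C(lam, circleRadius z s lam),
        logBranch z ξ * ((ξ - a)⁻¹ * ((ξ - b)⁻¹ ^ 2))) * (b - a) ^ 2 =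
      2 * Real.pi * Complex.I * (logBranch z a - logBranch z b + 1 - a * b⁻¹) := by
  have hd := differentiableOn_logBranch hz s
  have hinv : ∀ {lam c}, c ∈ s → c ≠ lam →
      DifferentiableOn ℂ (fun ξ : ℂ => (ξ - c)⁻¹) (ray z ∪ (↑s \ {lam}))ᶜ := fun hc hcl =>
    (differentiableOn_id.sub_const _).inv fun ξ hξ => sub_ne_zero_of_mem_compl hc hcl hξ
  -- The pole at `a` is simple: Cauchy's integral formula.
  have hA : (∮ ξ in C(a, circleRadius z s a),
      logBranch z ξ * ((ξ - a)⁻¹ * ((ξ - b)⁻¹ ^ 2))) =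
      2 * Real.pi * Complex.I * (logBranch z a * (a - b)⁻¹ ^ 2) := by
    have h1 : DifferentiableOn ℂ (fun ξ => logBranch z ξ * (ξ - b)⁻¹ ^ 2)
        (ray z ∪ (↑s \ {a}))ᶜ := (hd a).mul ((hinv hb hab.symm).pow 2)
    have h2 := (h1.mono (closedBall_circleRadius_subset (hs a ha))).diffContOnCl_ball
      subset_rfl |>.circleIntegral_sub_inv_smul (mem_ball_self (circleRadius_pos (hs a ha)))
    rw [smul_eq_mul] at h2
    rw [← h2]
    congr 1
    funext ξ
    rw [smul_eq_mul]
    ring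
  -- The pole at `b` is double, so the derivative of `log_z(ξ) (ξ - a)⁻¹` enters. Its summand with
  -- `b⁻¹`, multiplied by `(b - a)²`, is the source of `1 - a b⁻¹`.
  have hB : (∮ ξ in C(b, circleRadius z s b),
      logBranch z ξ * ((ξ - a)⁻¹ * ((ξ - b)⁻¹ ^ 2))) =
      2 * Real.pi * Complex.I * (b⁻¹ * (b - a)⁻¹ - logBranch z b * (b - a)⁻¹ ^ 2) := by
    have h1 : DifferentiableOn ℂ (fun ξ => logBranch z ξ * (ξ - a)⁻¹)
        (ray z ∪ (↑s \ {b}))ᶜ := (hd b).mul (hinv ha hab)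
    have h2 := Complex.two_pi_I_inv_smul_circleIntegral_sub_sq_inv_smul_of_differentiable
      (isClosed_ray_union z s b).isOpen_compl (closedBall_circleRadius_subset (hs b hb)) h1
      (mem_ball_self (circleRadius_pos (hs b hb)))
    have hba : b - a ≠ 0 := sub_ne_zero.2 hab.symm
    have h3 : HasDerivAt (fun ξ => logBranch z ξ * (ξ - a)⁻¹)
        (b⁻¹ * (b - a)⁻¹ + logBranch z b * (-1 / (b - a) ^ 2)) b :=
      (hasDerivAt_logBranch hz (hs b hb)).mul (((hasDerivAt_id b).sub_const a).inv hba)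
    rw [h3.deriv, inv_smul_eq_iff₀ Complex.two_pi_I_ne_zero] at h2
    have h4 : 2 * Real.pi * Complex.I * (b⁻¹ * (b - a)⁻¹ - logBranch z b * (b - a)⁻¹ ^ 2) =
        (2 * Real.pi * Complex.I) •
          (b⁻¹ * (b - a)⁻¹ + logBranch z b * (-1 / (b - a) ^ 2)) := by
      rw [smul_eq_mul]; field_simp; ring
    rw [h4, ← h2]
    congr 1
    funext ξ
    rw [smul_eq_mul, inv_pow]
    ring
  have h0 : ∀ lam ∈ s, lam ≠ a ∧ lam ≠ b → (∮ ξ in C(lam, circleRadius z s lam),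
      logBranch z ξ * ((ξ - a)⁻¹ * ((ξ - b)⁻¹ ^ 2))) * (b - a) ^ 2 = 0 := by
    intro lam hlam ⟨h1, h2⟩
    have h3 : DifferentiableOn ℂ (fun ξ => logBranch z ξ * ((ξ - a)⁻¹ * ((ξ - b)⁻¹ ^ 2)))
        (ray z ∪ (↑s \ {lam}))ᶜ :=
      (hd lam).mul ((hinv ha h1.symm).mul ((hinv hb h2.symm).pow 2))
    rw [(h3.mono (closedBall_circleRadius_subset (hs lam hlam))).diffContOnCl_ball
      subset_rfl |>.circleIntegral_eq_zero (circleRadius_pos (hs lam hlam)).le, zero_mul]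
  rw [Finset.sum_eq_add_of_mem a b ha hb hab h0, hA, hB]
  have hb0 : b ≠ 0 := fun h => hs b hb (h ▸ zero_mem_ray z)
  have hba : b - a ≠ 0 := sub_ne_zero.2 hab.symm
  have hab' : a - b ≠ 0 := sub_ne_zero.2 hab
  field_simp
  ring

/-- The integrands of the contour integral are continuous on the contour. -/
theorem continuousOn_sphere_logBranch (hz : z ≠ 0) {lam : ℂ} (hlam : lam ∉ ray z)
    {a b : ℂ} (ha : a ∈ s) (hb : b ∈ s) :
    ContinuousOn (fun ξ => logBranch z ξ * ((ξ - a)⁻¹ * ((ξ - b)⁻¹ ^ 2)))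
      (sphere lam (circleRadius z s lam)) := by
  have hr := circleRadius_pos (s := s) hlam
  have hinv : ∀ {c}, c ∈ s →
      ContinuousOn (fun ξ : ℂ => (ξ - c)⁻¹) (sphere lam (circleRadius z s lam)) := by
    intro c hc
    refine (continuousOn_id.sub continuousOn_const).inv₀ fun ξ hξ => ?_
    by_cases h : c = lam
    · subst h
      exact sub_ne_zero.2 (ne_of_mem_sphere hξ hr.ne')
    · exact sub_ne_zero_of_mem_compl hc h
        (closedBall_circleRadius_subset hlam (sphere_subset_closedBall hξ))
  refine ContinuousOn.mul ?_ ((hinv ha).mul ((hinv hb).pow 2))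
  exact (differentiableOn_logBranch hz s lam).continuousOn.mono
    (sphere_subset_closedBall.trans (closedBall_circleRadius_subset hlam))

end Contour

variable {n : ℕ}

/-! ### Spectral decomposition and the contour integral -/

section Decomposition

open Metric

/-- A resolution of the identity by mutually orthogonal idempotents. -/
structure IsResolution (P : Fin n → Mat n) : Prop where
  mul_eq : ∀ i j, P i * P j = if i = j then P i else 0
  sum_eq : ∑ i, P i = 1

theorem isResolution_of_mem {P : Fin n → Mat n} (hP : P ∈ projTuples n) : IsResolution P := by
  refine ⟨fun i j => ?_, ?_⟩
  · split_ifs with h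
    · subst h; exact (hP.1 i).2.1
    · exact hP.2 i j h
  -- That the projections add up to the identity is not among the defining equations; it comes from
  -- conjugating the diagonal matrix units.
  · obtain ⟨g, hg, rfl⟩ := (mem_projTuples_iff P).1 hP
    have h1 : ∑ i, Matrix.single i i (1 : ℂ) = (1 : Mat n) := by
      ext a b
      rw [Matrix.sum_apply]
      simp [Matrix.single_apply, Matrix.one_apply, ite_and]
    have h2 : g * star g = 1 := hg.1.2
    simp only [cosetProj]
    rw [← Finset.sum_mul, ← Finset.mul_sum, h1, mul_one, h2]

theorem IsResolution.sum_smul_mul {P : Fin n → Mat n} (hP : IsResolution P) (a b : Fin n → ℂ) :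
    (∑ i, a i • P i) * (∑ i, b i • P i) = ∑ i, (a i * b i) • P i := by
  rw [Finset.sum_mul_sum]
  refine Finset.sum_congr rfl fun i _ => ?_
  simp [hP.mul_eq, smul_smul, mul_comm]

/-- Combinations of the `P i` multiply coefficientwise, so they are inverted coefficientwise. -/
theorem IsResolution.resolvent {P : Fin n → Mat n} (hP : IsResolution P) {a : Fin n → ℂ} {ξ : ℂ}
    (hξ : ∀ i, ξ - a i ≠ 0) :
    (ξ • (1 : Mat n) - ∑ i, a i • P i)⁻¹ = ∑ i, (ξ - a i)⁻¹ • P i := by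
  refine Matrix.inv_eq_right_inv ?_
  have h : ξ • (1 : Mat n) - ∑ i, a i • P i = ∑ i, (ξ - a i) • P i := by
    rw [← hP.sum_eq, Finset.smul_sum, ← Finset.sum_sub_distrib]
    simp only [sub_smul]
  rw [h, hP.sum_smul_mul, ← hP.sum_eq]
  exact Finset.sum_congr rfl fun i _ => by rw [mul_inv_cancel₀ (hξ i), one_smul]

variable {E : Type*} [NormedAddCommGroup E] [NormedSpace ℝ E] [FiniteDimensional ℝ E]

theorem traceForm_sum_smul (P : Fin n → Mat n) (a b : Fin n → ℂ) (θ η : E →ₗ[ℝ] Mat n) :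
    traceForm (∑ i, a i • P i) θ (∑ i, b i • P i) η =
      ∑ i, ∑ j, (a i * b j) • traceForm (P i) θ (P j) η := by
  ext v
  simp only [traceForm_apply, ContinuousAlternatingMap.sum_apply,
    ContinuousAlternatingMap.smul_apply, Finset.sum_mul, Finset.mul_sum, Matrix.trace_sum,
    Matrix.smul_mul, Matrix.mul_smul, Matrix.trace_smul, smul_sub, Finset.sum_sub_distrib, smul_smul]
  congr 1 <;>
  · rw [Finset.sum_comm]
    simp only [mul_comm]

/-- Cyclicity of the trace exchanges the two arguments, so the antisymmetrisation cancels. This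
disposes of the terms with `i = j` in the double sum. -/
theorem traceForm_self (A : Mat n) (θ : E →ₗ[ℝ] Mat n) : traceForm A θ A θ = 0 := by
  ext v
  rw [traceForm_apply, Matrix.mul_assoc (A * θ (v 0)), Matrix.trace_mul_comm]
  simp [Matrix.mul_assoc]

/-- The contour integral in the curving, for a matrix in spectral form. -/
theorem sum_circleIntegral_traceForm {P : Fin n → Mat n} (hP : IsResolution P) {a : Fin n → ℂ}
    {z : ℂ} (hz : z ≠ 0) (ha : ∀ i, a i ∉ ray z) {s : Finset ℂ} (hs : s = Finset.univ.image a)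
    (θ : E →ₗ[ℝ] Mat n) :
    ∑ lam ∈ s, ∮ ξ in C(lam, circleRadius z s lam), logBranch z ξ •
        traceForm (ξ • (1 : Mat n) - ∑ i, a i • P i)⁻¹ θ
          ((ξ • (1 : Mat n) - ∑ i, a i • P i)⁻¹ ^ 2) θ =
      ∑ i, ∑ j, (∑ lam ∈ s, (∮ ξ in C(lam, circleRadius z s lam),
        logBranch z ξ * ((ξ - a i)⁻¹ * ((ξ - a j)⁻¹ ^ 2)))) • traceForm (P i) θ (P j) θ := by
  have hmem : ∀ i, a i ∈ s := fun i => hs ▸ Finset.mem_image_of_mem a (Finset.mem_univ i)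
  have key : ∀ lam ∈ s, (∮ ξ in C(lam, circleRadius z s lam), logBranch z ξ •
        traceForm (ξ • (1 : Mat n) - ∑ i, a i • P i)⁻¹ θ
          ((ξ • (1 : Mat n) - ∑ i, a i • P i)⁻¹ ^ 2) θ) =
      ∑ i, ∑ j, (∮ ξ in C(lam, circleRadius z s lam),
        logBranch z ξ * ((ξ - a i)⁻¹ * ((ξ - a j)⁻¹ ^ 2))) • traceForm (P i) θ (P j) θ := by
    intro lam hlam
    have hl : lam ∉ ray z := by
      rw [hs] at hlam
      obtain ⟨i, -, rfl⟩ := Finset.mem_image.1 hlam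
      exact ha i
    have hr := circleRadius_pos (s := s) hl
    have hint : ∀ i j, CircleIntegrable (fun ξ => (logBranch z ξ *
        ((ξ - a i)⁻¹ * ((ξ - a j)⁻¹ ^ 2))) • traceForm (P i) θ (P j) θ) lam
        (circleRadius z s lam) := fun i j => by
      have h := continuousOn_sphere_logBranch hz hl (hmem i) (hmem j)
      exact (h.smul continuousOn_const).circleIntegrable hr.le
    have hcongr : EqOn (fun ξ => logBranch z ξ •
        traceForm (ξ • (1 : Mat n) - ∑ i, a i • P i)⁻¹ θ
          ((ξ • (1 : Mat n) - ∑ i, a i • P i)⁻¹ ^ 2) θ)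
        (fun ξ => ∑ i, ∑ j, (logBranch z ξ *
          ((ξ - a i)⁻¹ * ((ξ - a j)⁻¹ ^ 2))) • traceForm (P i) θ (P j) θ)
        (sphere lam (circleRadius z s lam)) := by
      intro ξ hξ
      have hne : ∀ i, ξ - a i ≠ 0 := by
        intro i
        by_cases h : a i = lam
        · rw [h]
          exact sub_ne_zero.2 (ne_of_mem_sphere hξ hr.ne')
        · exact sub_ne_zero_of_mem_compl (hmem i) h
            (closedBall_circleRadius_subset hl (sphere_subset_closedBall hξ))
      dsimp only
      rw [hP.resolvent hne, pow_two, hP.sum_smul_mul, traceForm_sum_smul, Finset.smul_sum]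
      simp only [Finset.smul_sum, smul_smul, pow_two]
    rw [circleIntegral.integral_congr hr.le hcongr, circleIntegral.integral_fun_sum]
    · refine Finset.sum_congr rfl fun i _ => ?_
      rw [circleIntegral.integral_fun_sum fun j _ => hint i j]
      exact Finset.sum_congr rfl fun j _ => circleIntegral.integral_smul_const _ _ _ _
    · intro i _
      have := CircleIntegrable.sum Finset.univ fun j _ => hint i j
      convert! this using 1
      ext1 ξ
      simp
  rw [Finset.sum_congr rfl key, Finset.sum_comm]
  refine Finset.sum_congr rfl fun i _ => ?_
  rw [Finset.sum_comm]
  exact Finset.sum_congr rfl fun j _ => (Finset.sum_smul).symm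

theorem contourRadius_eq {z : ℂ} {g : Mat n} (lam : ℂ) :
    contourRadius z g lam = circleRadius z g.charpoly.roots.toFinset lam := by
  have : (↑g.charpoly.roots.toFinset : Set ℂ) = spectrum ℂ g := by
    ext μ
    rw [Matrix.mem_spectrum_iff_isRoot_charpoly, Finset.mem_coe, Multiset.mem_toFinset,
      Polynomial.mem_roots g.charpoly_monic.ne_zero]
  rw [contourRadius, circleRadius, this]

theorem roots_toFinset_charpoly_weylMap {x : Mat n × (Fin n → Mat n)} (hx : x ∈ base n) :
    (weylMap x).charpoly.roots.toFinset = Finset.univ.image fun i => x.1 i i := by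
  ext μ
  rw [Multiset.mem_toFinset, Polynomial.mem_roots (Matrix.charpoly_monic _).ne_zero,
    ← Matrix.mem_spectrum_iff_isRoot_charpoly, spectrum_weylMap hx]
  simp

theorem norm_apply_of_mem_torus {t : Mat n} (ht : t ∈ torus n) (k : Fin n) : ‖t k k‖ = 1 := by
  have h1 : star t * t = 1 := ht.1.1.1
  have h2 : star (t k k) * t k k = 1 := by
    have h3 := congrFun (congrFun h1 k) k
    rw [Matrix.mul_apply, Finset.sum_eq_single k] at h3
    · simpa using h3
    · intro b _ hb
      rw [ht.2 hb, mul_zero]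
    · simp
  have h4 := congrArg norm h2
  rw [norm_mul, norm_star, norm_one] at h4
  nlinarith [norm_nonneg (t k k)]

theorem notMem_ray_of_mem_weylY {y : ℂ × (Mat n × (Fin n → Mat n))} (hy : y ∈ weylY n)
    (k : Fin n) : y.2.1 k k ∉ ray y.1 :=
  notMem_ray_of_norm_eq hy.2.1.1 (norm_apply_of_mem_torus hy.1.1 k) (hy.2.2 k)

end Decomposition

/-- The topology of the norm on matrices. -/
abbrev matTopology (n : ℕ) : TopologicalSpace (Mat n) :=
  (Matrix.normedAddCommGroup : NormedAddCommGroup (Mat n)).toPseudoMetricSpace.toUniformSpace.toTopologicalSpace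

/-- The additive structure of the normed space of matrices. -/
abbrev matAddCommMonoid (n : ℕ) : AddCommMonoid (Mat n) :=
  (Matrix.normedAddCommGroup : NormedAddCommGroup (Mat n)).toAddCommGroup.toAddCommMonoid

/-- The real vector space structure of the normed space of matrices. -/
abbrev matModule (n : ℕ) : Module ℝ (Mat n) :=
  (Matrix.normedSpace : NormedSpace ℝ (Mat n)).toModule

attribute [local instance] matTopology matAddCommMonoid matModule

/-! ### Linearised equations of `T × SU(n)/T` -/

section TangentVectors

/-- Matrix multiplication as a continuous bilinear map. -/
def mulCLM (n : ℕ) : Mat n →L[ℝ] Mat n →L[ℝ] Mat n :=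
  LinearMap.toContinuousLinearMap
    (LinearMap.toContinuousLinearMap.toLinearMap ∘ₗ LinearMap.mul ℝ (Mat n))

/-- An entry of a matrix as a continuous linear map. -/
def entryCLM (k l : Fin n) : Mat n →L[ℝ] ℂ :=
  LinearMap.toContinuousLinearMap (Matrix.entryLinearMap ℝ ℂ k l)

/-- The `k`-th diagonal entry of the torus component. -/
def diagCLM (k : Fin n) : (Mat n × (Fin n → Mat n)) →L[ℝ] ℂ :=
  (entryCLM k k).comp (ContinuousLinearMap.fst ℝ _ _)

theorem diagCLM_apply (k : Fin n) (x : Mat n × (Fin n → Mat n)) : diagCLM k x = x.1 k k := rfl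

/-- The `k`-th projection of the second component. -/
def projCLM (k : Fin n) : (Mat n × (Fin n → Mat n)) →L[ℝ] Mat n :=
  (ContinuousLinearMap.proj k).comp (ContinuousLinearMap.snd ℝ _ _)

/-- The linearisation of the equations of a resolution of the identity. -/
structure IsResolutionTangent (P Q : Fin n → Mat n) : Prop where
  mul_add_mul : ∀ i j, Q i * P j + P i * Q j = if i = j then Q i else 0
  sum_eq : ∑ i, Q i = 0

variable {x v : Mat n × (Fin n → Mat n)}

theorem exists_hasFDerivAt_mul (i j : Fin n) (x : Mat n × (Fin n → Mat n)) :
    ∃ L : (Mat n × (Fin n → Mat n)) →L[ℝ] Mat n,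
      HasFDerivAt (fun y : Mat n × (Fin n → Mat n) => y.2 i * y.2 j) L x ∧
        ∀ v, L v = x.2 i * v.2 j + v.2 i * x.2 j := by
  have h := ((mulCLM n).isBoundedBilinearMap.hasFDerivAt (projCLM i x, projCLM j x)).comp x
    ((projCLM i).hasFDerivAt.prodMk (projCLM j).hasFDerivAt)
  exact ⟨_, h, fun _ => rfl⟩

/-- Differentiates `P_i P_j = δ_ij P_i` and `∑ P_i = 1`. The trace identities for `dP_k` below use
nothing else about tangent vectors. -/
theorem isResolutionTangent_of_mem (hv : v ∈ tangent (base n) x) :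
    IsResolutionTangent x.2 v.2 := by
  constructor
  · intro i j
    obtain ⟨L, hL, hL'⟩ := exists_hasFDerivAt_mul i j x
    by_cases hij : i = j
    · have h0 := hasFDerivAt_tangent_eq_zero (c := 0) (hL.sub (projCLM i).hasFDerivAt)
        (fun y hy => by
          change y.2 i * y.2 j - y.2 i = 0
          rw [(isResolution_of_mem hy.2).mul_eq, if_pos hij, sub_self]) hv
      rw [if_pos hij, add_comm, ← hL']
      exact sub_eq_zero.1 h0
    · have h0 := hasFDerivAt_tangent_eq_zero (c := 0) hL
        (fun y hy => by rw [(isResolution_of_mem hy.2).mul_eq, if_neg hij]) hv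
      rw [if_neg hij, add_comm, ← hL', h0]
  · ext a b
    have h : HasFDerivAt (fun y : Mat n × (Fin n → Mat n) => ∑ i, y.2 i a b)
        (∑ i, entryCLM a b ∘L projCLM i) x :=
      HasFDerivAt.fun_sum fun i _ => (entryCLM a b ∘L projCLM i).hasFDerivAt
    have h0 := hasFDerivAt_tangent_eq_zero (c := (1 : Mat n) a b) h
      (fun y hy => by rw [← (isResolution_of_mem hy.2).sum_eq, Matrix.sum_apply]) hv
    rw [sum_apply] at h0
    rw [Matrix.sum_apply]
    exact h0

theorem isHermitian_of_mem_tangent (hv : v ∈ tangent (base n) x) (k : Fin n) :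
    (v.2 k).IsHermitian := by
  ext a b
  have h1 := ((Complex.conjCLE : ℂ →L[ℝ] ℂ) ∘L (entryCLM b a ∘L projCLM k)).hasFDerivAt
    (x := x) |>.sub (entryCLM a b ∘L projCLM k).hasFDerivAt
  have h0 := hasFDerivAt_tangent_eq_zero (c := 0) h1 (fun y hy =>
    sub_eq_zero.2 (congrFun (congrFun (hy.2.1 k).1 a) b)) hv
  exact sub_eq_zero.1 h0

theorem isDiag_of_mem_tangent (hv : v ∈ tangent (base n) x) : v.1.IsDiag := by
  intro a b hab
  have h := (entryCLM a b ∘L ContinuousLinearMap.fst ℝ (Mat n) (Fin n → Mat n)).hasFDerivAt (x := x)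
  exact hasFDerivAt_tangent_eq_zero (c := 0) h (fun y hy => hy.1.2 hab) hv

/-- Differentiates `|t_k|² = 1`; consequently `dt_k / t_k` is purely imaginary. -/
theorem star_mul_add_of_mem_tangent (hv : v ∈ tangent (base n) x) (k : Fin n) :
    star (x.1 k k) * v.1 k k + star (v.1 k k) * x.1 k k = 0 := by
  have h1 : HasFDerivAt (fun y : Mat n × (Fin n → Mat n) => star (y.1 k k))
      ((Complex.conjCLE : ℂ →L[ℝ] ℂ) ∘L diagCLM k) x :=
    ((Complex.conjCLE : ℂ →L[ℝ] ℂ) ∘L diagCLM k).hasFDerivAt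
  have h := h1.mul (diagCLM k).hasFDerivAt
  have h0 := hasFDerivAt_tangent_eq_zero (c := 1) h (fun y hy => by
    have h2 := norm_apply_of_mem_torus hy.1 k
    have h3 := Complex.conj_mul' (y.1 k k)
    simpa [diagCLM_apply, h2] using h3) hv
  change star (x.1 k k) * v.1 k k + x.1 k k * star (v.1 k k) = 0 at h0
  rw [← h0, mul_comm (x.1 k k)]

theorem prod_apply_of_mem_torus {t : Mat n} (ht : t ∈ torus n) : ∏ k, t k k = 1 := by
  have h1 : t.det = 1 := ht.1.2
  rw [← ht.2.diagonal_diag, Matrix.det_diagonal] at h1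
  exact h1

theorem apply_ne_zero_of_mem_torus {t : Mat n} (ht : t ∈ torus n) (k : Fin n) : t k k ≠ 0 :=
  norm_ne_zero_iff.1 (by rw [norm_apply_of_mem_torus ht k]; exact one_ne_zero)

/-- The logarithmic derivative of `∏ t_k = 1`. -/
theorem sum_div_of_mem_tangent (hx : x ∈ base n) (hv : v ∈ tangent (base n) x) :
    ∑ k, v.1 k k * (x.1 k k)⁻¹ = 0 := by
  have h := HasFDerivAt.finsetProd (u := Finset.univ) (x := x)
    fun k _ => (diagCLM (n := n) k).hasFDerivAt
  have h0 := hasFDerivAt_tangent_eq_zero (c := 1) h (fun y hy => by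
    simpa [diagCLM_apply] using prod_apply_of_mem_torus hy.1) hv
  rw [← h0, sum_apply]
  refine Finset.sum_congr rfl fun k _ => ?_
  have h1 := prod_apply_of_mem_torus hx.1
  rw [← Finset.mul_prod_erase Finset.univ _ (Finset.mem_univ k)] at h1
  change _ = (∏ j ∈ Finset.univ.erase k, x.1 j j) * v.1 k k
  rw [mul_comm, eq_inv_of_mul_eq_one_right h1]

theorem hasFDerivAt_weylMap (x : Mat n × (Fin n → Mat n)) :
    HasFDerivAt weylMap (∑ k, (x.1 k k • projCLM k + (diagCLM k).smulRight (x.2 k))) x :=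
  HasFDerivAt.fun_sum fun k _ => (diagCLM k).hasFDerivAt.smul (projCLM k).hasFDerivAt

end TangentVectors

/-! ### Trace identities for projections and their derivatives -/

section Algebra

variable {P Q Q' : Fin n → Mat n}

/-- Multiply the linearised relation for `Q k * P j` by `P i`. A block `P i * Q k * P j` can be
nonzero only if exactly one of `i`, `j` equals `k`; in particular `Q k` is off-diagonal with respect
to `P k`. -/
theorem IsResolution.mul_mul (hP : IsResolution P) (hQ : IsResolutionTangent P Q) (i j k : Fin n) :
    P i * Q k * P j = (if k = j then P i * Q j else 0) - (if i = k then P i * Q j else 0) := by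
  have h1 : Q k * P j = (if k = j then Q k else 0) - P k * Q j :=
    eq_sub_of_add_eq (hQ.mul_add_mul k j)
  rw [mul_assoc, h1, mul_sub, ← mul_assoc, hP.mul_eq]
  split_ifs <;> simp_all

/-- The sum is a value of `dg` for `g = ∑ a_k P_k`. Between `P i` and `P j` the terms with `τ` die,
and only `k = j` and `k = i` contribute, with opposite signs. -/
theorem IsResolution.mul_weyl_mul (hP : IsResolution P) (hQ : IsResolutionTangent P Q)
    (a τ : Fin n → ℂ) {i j : Fin n} (hij : i ≠ j) :
    P i * (∑ k, (a k • Q k + τ k • P k)) * P j = (a j - a i) • (P i * Q j) := by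
  have h : ∀ k, P i * (a k • Q k + τ k • P k) * P j =
      (if k = j then a k • (P i * Q j) else 0) - (if i = k then a k • (P i * Q j) else 0) := by
    intro k
    rw [mul_add, add_mul, Matrix.mul_smul, Matrix.smul_mul, hP.mul_mul hQ, Matrix.mul_smul,
      Matrix.smul_mul, hP.mul_eq i k]
    have : (if i = k then P i else 0) * P j = 0 := by
      split_ifs
      · rw [hP.mul_eq, if_neg hij]
      · rw [zero_mul]
    rw [this, smul_zero, add_zero, smul_sub]
    split_ifs <;> simp
  rw [Finset.mul_sum, Finset.sum_mul, Finset.sum_congr rfl fun k _ => h k, Finset.sum_sub_distrib]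
  simp [sub_smul]

theorem IsResolution.trace_mul_left (hP : IsResolution P) (i : Fin n) (X : Mat n) :
    (P i * X).trace = (P i * X * P i).trace := by
  rw [Matrix.trace_mul_comm (P i * X), ← mul_assoc, hP.mul_eq, if_pos rfl]

/-- The block `P_i dg P_j` contributes `a_j - a_i` and `P_j dg P_i` contributes `a_i - a_j`; the
sign is absorbed by `P_j dP_i = -dP_j P_i`. The resulting square cancels the poles at `a_i = a_j` in
the residues. -/
theorem IsResolution.trace_weyl (hP : IsResolution P) (hQ : IsResolutionTangent P Q)
    (hQ' : IsResolutionTangent P Q') (a τ τ' : Fin n → ℂ) {i j : Fin n} (hij : i ≠ j) :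
    (P i * (∑ k, (a k • Q k + τ k • P k)) * P j * (∑ k, (a k • Q' k + τ' k • P k))).trace =
      (a j - a i) ^ 2 * (P i * Q j * Q' j).trace := by
  have h1 : P i * Q j * P j = P i * Q j := by
    rw [hP.mul_mul hQ, if_pos rfl, if_neg hij, sub_zero]
  have h2 : P j * Q' i = -(Q' j * P i) := by
    have := hQ'.mul_add_mul j i
    rw [if_neg hij.symm] at this
    exact eq_neg_of_add_eq_zero_right this
  rw [hP.mul_weyl_mul hQ a τ hij, Matrix.smul_mul, Matrix.trace_smul, ← h1, mul_assoc (P i * Q j),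
    mul_assoc (P i), hP.trace_mul_left, mul_assoc (P i), mul_assoc (Q j),
    hP.mul_weyl_mul hQ' a τ' hij.symm, h2, Matrix.mul_smul, Matrix.mul_smul, Matrix.trace_smul,
    mul_neg, mul_neg, Matrix.trace_neg]
  rw [← mul_assoc (Q j), ← mul_assoc (P i), ← hP.trace_mul_left, ← mul_assoc (P i), h1]
  simp only [smul_eq_mul]
  ring

/-- Moving the derivative from one projection to the other costs two signs, which cancel, while
cyclicity reverses the order of the arguments. After antisymmetrisation, `tr(P_j dP_i dP_i) =
-tr(P_i dP_j dP_j)`. -/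
theorem IsResolution.trace_swap (hP : IsResolution P) (hQ : IsResolutionTangent P Q)
    (hQ' : IsResolutionTangent P Q') {i j : Fin n} (hij : i ≠ j) :
    (P j * Q i * Q' i).trace = (P i * Q' j * Q j).trace := by
  have h2 : P j * Q i = -(Q j * P i) := by
    have := hQ.mul_add_mul j i
    rw [if_neg hij.symm] at this
    exact eq_neg_of_add_eq_zero_right this
  have h3 : Q' i * P j = -(P i * Q' j) := by
    have := hQ'.mul_add_mul i j
    rw [if_neg hij] at this
    exact eq_neg_of_add_eq_zero_left this
  rw [mul_assoc, hP.trace_mul_left, ← mul_assoc, h2, mul_assoc, h3, neg_mul_neg, mul_assoc,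
    ← mul_assoc (P i), hP.mul_eq, if_pos rfl, Matrix.trace_mul_comm]

/-- Cubic expressions `Q_k Q_k Q_k` are odd with respect to `P_k`. -/
theorem IsResolutionTangent.trace_mul_mul (hQ : IsResolutionTangent P Q)
    (hP : IsResolution P) (hQ' : IsResolutionTangent P Q') {Q'' : Fin n → Mat n}
    (hQ'' : IsResolutionTangent P Q'') (k : Fin n) : (Q k * Q' k * Q'' k).trace = 0 := by
  have h : ∀ {R : Fin n → Mat n}, IsResolutionTangent P R → R k * P k + P k * R k = R k :=
    fun hR => by simpa using hR.mul_add_mul k k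
  have hz : P k * Q'' k * P k = 0 := by rw [hP.mul_mul hQ'']; simp
  have hPP : P k * P k = P k := by simpa using hP.mul_eq k k
  have e1 := h hQ
  have e2 := h hQ'
  have e3 := h hQ''
  set p := P k
  set q := Q k
  set q' := Q' k
  set q'' := Q'' k
  have c1 : q' * p = q' - p * q' := eq_sub_of_add_eq e2
  have c0 : q * p = q - p * q := eq_sub_of_add_eq e1
  have c2 : q'' * p = q'' - p * q'' := eq_sub_of_add_eq e3
  -- A product of two matrices odd with respect to `p` is even, that is, commutes with `p`.
  have comm : q * q' * p = p * (q * q') := by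
    rw [mul_assoc, c1, mul_sub, ← mul_assoc q p, c0, sub_mul]
    noncomm_ring
  -- Since `q * q'` commutes with `p`, a further `p` can be placed on the other side of `q''`, and
  -- `p * q'' * p = 0`.
  have t1 : (q * q' * p * q'').trace = 0 := by
    have : q * q' * p = p * (q * q' * p) := by rw [← mul_assoc, ← comm, mul_assoc _ p p, hPP]
    rw [this, mul_assoc, Matrix.trace_mul_comm, mul_assoc _ q'', mul_assoc _ p, ← mul_assoc p, hz,
      mul_zero, Matrix.trace_zero]
  have t2 : (q * q' * (q'' * p)).trace = 0 := by
    rw [← mul_assoc, Matrix.trace_mul_comm, ← mul_assoc, ← comm, t1]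
  rw [← e3, mul_add, Matrix.trace_add, ← mul_assoc _ p, t1, t2, add_zero]

/-- Deleting the diagonal of `c` gives an antisymmetric matrix with row sums `c i i` and column sums
`-c j j`. So `ℓ i` and `-ℓ j` contribute equally, the constant `1` contributes nothing, and the
ratios remain. -/
theorem sum_antisymm_coefficients (c : Fin n → Fin n → ℂ) (hc : ∀ i j, i ≠ j → c j i = -c i j)
    (hs : ∀ k, ∑ i, c i k = 0) (ℓ a : Fin n → ℂ) :
    ∑ i, ∑ j, (if i = j then 0 else (ℓ i - ℓ j + 1 - a i * (a j)⁻¹) * c i j) =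
      2 * ∑ k, ℓ k * c k k - ∑ i, ∑ k ∈ Finset.univ.erase i, a i * (a k)⁻¹ * c i k := by
  let d : Fin n → Fin n → ℂ := fun i j => if i = j then 0 else c i j
  have hd : ∀ i j, d j i = -d i j := by
    intro i j
    by_cases h : i = j
    · simp [d, h]
    · simp [d, h, Ne.symm h, hc i j h]
  have hcol : ∀ j, ∑ i, d i j = -c j j := by
    intro j
    rw [eq_neg_iff_add_eq_zero, ← hs j, ← Finset.sum_erase_add Finset.univ _ (Finset.mem_univ j),
      ← Finset.sum_erase_add Finset.univ (fun i => c i j) (Finset.mem_univ j)]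
    have : ∑ i ∈ Finset.univ.erase j, d i j = ∑ i ∈ Finset.univ.erase j, c i j :=
      Finset.sum_congr rfl fun i hi => if_neg (Finset.ne_of_mem_erase hi)
    rw [this]
    simp [d]
  have hrow : ∀ i, ∑ j, d i j = c i i := by
    intro i
    rw [Finset.sum_congr rfl fun j _ => hd j i, Finset.sum_neg_distrib, hcol, neg_neg]
  have h0 : ∑ i, ∑ j, d i j = 0 := by
    have : ∑ i, ∑ j, d i j = -∑ i, ∑ j, d i j := by
      conv_lhs => rw [Finset.sum_comm]
      simp_rw [← Finset.sum_neg_distrib]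
      exact Finset.sum_congr rfl fun i _ => Finset.sum_congr rfl fun j _ => hd i j
    exact self_eq_neg.1 this
  have h1 : ∑ i, ∑ j, ℓ i * d i j = ∑ k, ℓ k * c k k := by
    simp_rw [← Finset.mul_sum, hrow]
  have h2 : ∑ i, ∑ j, ℓ j * d i j = -∑ k, ℓ k * c k k := by
    rw [Finset.sum_comm]
    simp_rw [← Finset.mul_sum, hcol, mul_neg, Finset.sum_neg_distrib]
  have h3 : ∑ i, ∑ j, a i * (a j)⁻¹ * d i j =
      ∑ i, ∑ k ∈ Finset.univ.erase i, a i * (a k)⁻¹ * c i k := by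
    refine Finset.sum_congr rfl fun i _ => ?_
    rw [← Finset.sum_erase_add Finset.univ _ (Finset.mem_univ i)]
    simp only [d, if_true, mul_zero, add_zero]
    exact Finset.sum_congr rfl fun k hk => by rw [if_neg (Finset.ne_of_mem_erase hk).symm]
  have h4 : ∀ i j, (if i = j then 0 else (ℓ i - ℓ j + 1 - a i * (a j)⁻¹) * c i j) =
      ℓ i * d i j - ℓ j * d i j + d i j - a i * (a j)⁻¹ * d i j := by
    intro i j
    by_cases h : i = j
    · simp [d, h]
    · simp only [d, if_neg h]
      ring
  simp_rw [h4, Finset.sum_sub_distrib, Finset.sum_add_distrib, Finset.sum_sub_distrib]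
  rw [h0, h1, h2, h3]
  ring

end Algebra

/-! ### The formula for the curving -/

section Curving

theorem weylLift_tangentMap_snd (y : weylY n) (v : tangent (weylY n) y.1) :
    ((weylLift n).tangentMap y v).1.2 =
      ∑ k, (y.1.2.1 k k • v.1.2.2 k + v.1.2.1 k k • y.1.2.2 k) := by
  have h := hasFDerivAt_fst (𝕜 := ℝ) (p := y.1) |>.prodMk
    ((hasFDerivAt_weylMap y.1.2).comp y.1 (hasFDerivAt_snd (𝕜 := ℝ) (p := y.1)))
  have h2 : fderiv ℝ (weylLift n).toFun y.1 = _ := h.fderiv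
  change (fderiv ℝ (weylLift n).toFun y.1 v.1).2 = _
  rw [h2]
  change (∑ k, (y.1.2.1 k k • projCLM k + (diagCLM k).smulRight (y.1.2.2 k))) v.1.2 = _
  rw [sum_apply]
  rfl

theorem projBase_tangentMap (y : weylY n) (v : tangent (weylY n) y.1) :
    ((projBase n).tangentMap y v).1 = v.1.2 := by
  have h2 : fderiv ℝ (projBase n).toFun y.1 = _ :=
    (hasFDerivAt_snd (𝕜 := ℝ) (p := y.1)).fderiv
  change fderiv ℝ (projBase n).toFun y.1 v.1 = _
  rw [h2]
  rfl

theorem snd_mem_tangent (y : weylY n) (v : tangent (weylY n) y.1) :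
    v.1.2 ∈ tangent (base n) y.1.2 :=
  projBase_tangentMap y v ▸ ((projBase n).tangentMap y v).2

/-- The matrix-valued one-form `dg` on `Y`. -/
def dgForm (y : basicY n) : tangent (basicY n) y.1 →ₗ[ℝ] Mat n :=
  LinearMap.snd ℝ ℂ (Mat n) ∘ₗ (tangent (basicY n) y.1).subtype

theorem ne_zero_of_mem_weylY {y : ℂ × (Mat n × (Fin n → Mat n))} (hy : y ∈ weylY n) : y.1 ≠ 0 :=
  norm_ne_zero_iff.1 (by rw [hy.2.1.1]; exact one_ne_zero)

theorem basicCurving_weylLift (y : weylY n) :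
    basicCurving n ((weylLift n).onPoint y) = (1 / (8 * (Real.pi : ℂ) ^ 2)) •
      ∑ i, ∑ j, (∑ lam ∈ Finset.univ.image fun k => y.1.2.1 k k,
        (∮ ξ in C(lam, circleRadius y.1.1 (Finset.univ.image fun k => y.1.2.1 k k) lam),
        logBranch y.1.1 ξ * ((ξ - y.1.2.1 i i)⁻¹ * ((ξ - y.1.2.1 j j)⁻¹ ^ 2)))) •
          traceForm (y.1.2.2 i) (dgForm ((weylLift n).onPoint y)) (y.1.2.2 j)
            (dgForm ((weylLift n).onPoint y)) := by
  rw [← sum_circleIntegral_traceForm (isResolution_of_mem y.2.1.2) (ne_zero_of_mem_weylY y.2)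
    (notMem_ray_of_mem_weylY y.2) rfl, ← roots_toFinset_charpoly_weylMap y.2.1]
  simp only [← contourRadius_eq]
  rfl

theorem pulledCurving_eq (n : ℕ) : pulledCurving n = fun y =>
    (∑ k, ((-1 / (2 * Real.pi * Complex.I)) *
        logBranch y.1.1 (p k ((projBase n).onPoint y))) •
      (projBase n).pullback (trPdPdP k k) y) +
    (projBase n).pullback (beta n) y := by
  funext y
  ext v
  have hP := isResolution_of_mem y.2.1.2
  have hQ : ∀ i, IsResolutionTangent y.1.2.2 (v i).1.2.2 := fun i =>
    isResolutionTangent_of_mem (snd_mem_tangent y (v i))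
  set P := y.1.2.2
  set a : Fin n → ℂ := fun k => y.1.2.1 k k with ha
  set c : Fin n → Fin n → ℂ := fun i j =>
    (P i * (v 0).1.2.2 j * (v 1).1.2.2 j).trace - (P i * (v 1).1.2.2 j * (v 0).1.2.2 j).trace with hc
  set z := y.1.1
  have htr : ∀ i k, (projBase n).pullback (trPdPdP i k) y v = c i k := by
    intro i k
    change (P i * ((projBase n).tangentMap y (v 0)).1.2 k * 1 *
      ((projBase n).tangentMap y (v 1)).1.2 k).trace -
      (P i * ((projBase n).tangentMap y (v 1)).1.2 k * 1 *
      ((projBase n).tangentMap y (v 0)).1.2 k).trace = _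
    simp only [projBase_tangentMap, mul_one, hc]
  have hbeta : (projBase n).pullback (beta n) y v = (-(Complex.I / (4 * Real.pi))) *
      ∑ i, ∑ k ∈ Finset.univ.erase i, a i * (a k)⁻¹ * c i k := by
    simp only [SmoothMap.pullback, beta, ContinuousAlternatingMap.compContinuousLinearMap_apply,
      ContinuousAlternatingMap.smul_apply, ContinuousAlternatingMap.sum_apply, smul_eq_mul]
    simp only [← htr]
    rfl
  have hanti : ∀ i j, i ≠ j → c j i = -c i j := by
    intro i j hij
    simp only [hc]
    rw [hP.trace_swap (hQ 0) (hQ 1) hij, hP.trace_swap (hQ 1) (hQ 0) hij]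
    ring
  -- Summing over `i` replaces `P i` by the identity, and the trace of a commutator is zero.
  have hsum : ∀ k, ∑ i, c i k = 0 := by
    intro k
    simp only [hc]
    rw [Finset.sum_sub_distrib, ← Matrix.trace_sum, ← Matrix.trace_sum, ← Finset.sum_mul,
      ← Finset.sum_mul, ← Finset.sum_mul, ← Finset.sum_mul, hP.sum_eq, one_mul, one_mul,
      Matrix.trace_mul_comm, sub_self]
  have hwt : ∀ i j, traceForm (P i) (dgForm ((weylLift n).onPoint y)) (P j)
      (dgForm ((weylLift n).onPoint y)) (fun l => (weylLift n).tangentMap y (v l)) =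
      if i = j then 0 else (a j - a i) ^ 2 * c i j := by
    intro i j
    by_cases hij : i = j
    · rw [if_pos hij, hij, traceForm_self]
      rfl
    · rw [if_neg hij, traceForm_apply]
      change (P i * ((weylLift n).tangentMap y (v 0)).1.2 * P j *
        ((weylLift n).tangentMap y (v 1)).1.2).trace - (P i * ((weylLift n).tangentMap y (v 1)).1.2
        * P j * ((weylLift n).tangentMap y (v 0)).1.2).trace = _
      simp only [weylLift_tangentMap_snd]
      rw [hP.trace_weyl (hQ 0) (hQ 1) a _ _ hij, hP.trace_weyl (hQ 1) (hQ 0) a _ _ hij, ← mul_sub]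
  have hlhs : pulledCurving n y v = (1 / (8 * (Real.pi : ℂ) ^ 2)) * ∑ i, ∑ j, (if i = j then 0 else
      2 * Real.pi * Complex.I * ((logBranch z (a i) - logBranch z (a j) + 1 - a i * (a j)⁻¹) *
        c i j)) := by
    rw [pulledCurving, SmoothMap.pullback, basicCurving_weylLift,
      ContinuousAlternatingMap.compContinuousLinearMap_apply]
    simp only [ContinuousAlternatingMap.smul_apply, ContinuousAlternatingMap.sum_apply,
      smul_eq_mul]
    congr 1
    refine Finset.sum_congr rfl fun i _ => Finset.sum_congr rfl fun j _ => ?_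
    refine (congrArg _ (hwt i j)).trans ?_
    by_cases hij : i = j
    · rw [if_pos hij, if_pos hij, mul_zero]
    · rw [if_neg hij, if_neg hij]
      -- For coinciding eigenvalues the residue formula is unavailable, but both sides vanish: the
      -- left by the factor `(a j - a i) ^ 2`, the right because `1 - a i * (a j)⁻¹ = 0` and the
      -- logarithms agree.
      by_cases haij : a i = a j
      · have : a j ≠ 0 := apply_ne_zero_of_mem_torus y.2.1.1 j
        rw [haij, mul_inv_cancel₀ this]
        ring
      · have h := sum_circleIntegral_logBranch (s := Finset.univ.image a)
          (ne_zero_of_mem_weylY y.2) (fun lam hlam => by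
            obtain ⟨k, -, rfl⟩ := Finset.mem_image.1 hlam
            exact notMem_ray_of_mem_weylY y.2 k) (Finset.mem_image_of_mem a (Finset.mem_univ i))
          (Finset.mem_image_of_mem a (Finset.mem_univ j)) haij
        rw [← mul_assoc, Finset.sum_mul, ← mul_assoc]
        exact congrArg (· * c i j) h
  rw [hlhs, ContinuousAlternatingMap.add_apply, hbeta, ContinuousAlternatingMap.sum_apply]
  simp only [ContinuousAlternatingMap.smul_apply, htr, smul_eq_mul]
  have hfac : ∀ i j, (if i = j then (0 : ℂ) else 2 * Real.pi * Complex.I *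
      ((logBranch z (a i) - logBranch z (a j) + 1 - a i * (a j)⁻¹) * c i j)) =
      2 * Real.pi * Complex.I * (if i = j then 0 else
        (logBranch z (a i) - logBranch z (a j) + 1 - a i * (a j)⁻¹) * c i j) := by
    intro i j
    split_ifs <;> simp
  simp only [hfac, ← Finset.mul_sum]
  rw [sum_antisymm_coefficients c hanti hsum]
  have hp : ∀ k, p k ((projBase n).onPoint y) = a k := fun _ => rfl
  have hpi : (Real.pi : ℂ) ≠ 0 := by exact_mod_cast Real.pi_ne_zero
  simp only [hp, mul_assoc (-1 / (2 * (Real.pi : ℂ) * Complex.I)), ← Finset.mul_sum]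
  -- Only constants remain: `2πi / 8π² = i / 4π`, and twice this is `-1 / (2πi)`.
  generalize ∑ k, logBranch z (a k) * c k k = X
  generalize ∑ i, ∑ k ∈ Finset.univ.erase i, a i * (a k)⁻¹ * c i k = Y
  field_simp
  rw [Complex.I_sq]
  ring

end Curving

/-! ### Ambient extensions of `β`, the curving and the three-curvature -/

section Curvature

theorem oneWedge_apply {V : Type*} [NormedAddCommGroup V] [NormedSpace ℝ V] {k : ℕ}
    (α : V →L[ℝ] ℂ) (σ : V [⋀^Fin k]→L[ℝ] ℂ) (v : Fin (k + 1) → V) :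
    oneWedge α σ v = ∑ i, (-1) ^ i.val • (α (v i) * σ (i.removeNth v)) := by
  rw [oneWedge, ContinuousAlternatingMap.alternatizeUncurryFin_apply]
  rfl

/-- The matrix-valued one-form `dP_k` on the ambient space. -/
def ambientdP (k : Fin n) : (Mat n × (Fin n → Mat n)) →ₗ[ℝ] Mat n :=
  LinearMap.proj k ∘ₗ LinearMap.snd ℝ (Mat n) (Fin n → Mat n)

/-- The two-form `tr(A dP_k dP_k)` on the ambient space, as a function of `A`. -/
def traceFormCLM (k : Fin n) : Mat n →L[ℝ] (Mat n × (Fin n → Mat n)) [⋀^Fin 2]→L[ℝ] ℂ :=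
  LinearMap.toContinuousLinearMap
    { toFun := fun A => traceForm A (ambientdP k) 1 (ambientdP k)
      map_add' := fun A B => by
        ext v
        simp only [traceForm_apply, ContinuousAlternatingMap.add_apply, add_mul, Matrix.trace_add]
        ring
      map_smul' := fun r A => by
        ext v
        simp only [traceForm_apply, ContinuousAlternatingMap.smul_apply, Matrix.smul_mul,
          Matrix.trace_smul, RingHom.id_apply, smul_sub] }

theorem traceFormCLM_apply (k : Fin n) (A : Mat n) (v : Fin 2 → Mat n × (Fin n → Mat n)) :
    traceFormCLM k A v =
      (A * (v 0).2 k * (v 1).2 k).trace - (A * (v 1).2 k * (v 0).2 k).trace := by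
  change (A * (v 0).2 k * 1 * (v 1).2 k).trace - (A * (v 1).2 k * 1 * (v 0).2 k).trace = _
  rw [mul_one, mul_one]

/-- The extension of `β` to the ambient space. -/
def ambientBeta (n : ℕ) (x : Mat n × (Fin n → Mat n)) :
    (Mat n × (Fin n → Mat n)) [⋀^Fin 2]→L[ℝ] ℂ :=
  (-(Complex.I / (4 * Real.pi))) •
    ∑ i, ∑ k ∈ Finset.univ.erase i, (x.1 i i * (x.1 k k)⁻¹) • traceFormCLM k (x.2 i)

theorem beta_eq (n : ℕ) : beta n = restrictForm (base n) (ambientBeta n) := by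
  funext x
  ext v
  simp only [beta, restrictForm, ambientBeta, ContinuousAlternatingMap.compContinuousLinearMap_apply,
    ContinuousAlternatingMap.smul_apply, ContinuousAlternatingMap.sum_apply]
  rfl

theorem contDiffAt_traceFormCLM_apply (i k : Fin n) (x : Mat n × (Fin n → Mat n))
    (v : Fin 2 → Mat n × (Fin n → Mat n)) :
    ContDiffAt ℝ ∞ (fun x : Mat n × (Fin n → Mat n) => traceFormCLM k (x.2 i) v) x := by
  have h := (ContinuousAlternatingMap.apply ℝ (Mat n × (Fin n → Mat n)) ℂ v ∘L traceFormCLM k ∘L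
    projCLM i).contDiff (n := ∞)
  exact h.contDiffAt

theorem contDiffAt_ambientBeta {x : Mat n × (Fin n → Mat n)} (hx : x ∈ base n) :
    ContDiffAt ℝ ∞ (ambientBeta n) x := by
  refine contDiffAt_alternating fun v => ?_
  have h : (fun x => ambientBeta n x v) = fun x => (-(Complex.I / (4 * Real.pi))) *
      ∑ i, ∑ k ∈ Finset.univ.erase i, (x.1 i i * (x.1 k k)⁻¹) * traceFormCLM k (x.2 i) v := by
    funext x
    simp only [ambientBeta, ContinuousAlternatingMap.smul_apply,
      ContinuousAlternatingMap.sum_apply, smul_eq_mul]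
  rw [h]
  refine contDiffAt_const.mul (ContDiffAt.sum fun i _ => ContDiffAt.sum fun k _ => ?_)
  refine ContDiffAt.mul (ContDiffAt.mul (diagCLM i).contDiff.contDiffAt ?_)
    (contDiffAt_traceFormCLM_apply i k x v)
  -- The extension is singular where a diagonal entry vanishes, which does not happen on the torus.
  exact (diagCLM k).contDiff.contDiffAt.inv (apply_ne_zero_of_mem_torus hx.1 k)

/-- The form `dβ` on `T × SU(n)/T`. -/
def dBeta (n : ℕ) : DiffForm (base n) 3 := restrictForm (base n) (extDeriv (ambientBeta n))

theorem isSmoothForm_beta (n : ℕ) : IsSmoothForm (beta n) :=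
  beta_eq n ▸ isSmoothForm_restrictForm fun _ hx => contDiffAt_ambientBeta hx

theorem isExtDeriv_beta (n : ℕ) : IsExtDeriv (beta n) (dBeta n) :=
  beta_eq n ▸ isExtDeriv_restrictForm fun _ hx => contDiffAt_ambientBeta hx

/-- The three-curvature of the pull-back of the basic bundle gerbe by the Weyl map. -/
def weylCurvature (n : ℕ) : DiffForm (base n) 3 := fun x =>
  (-(1 / (2 * Real.pi * Complex.I))) •
    (∑ k, oneWedge ((p k x)⁻¹ • dp k x) (trPdPdP k k x)) + dBeta n x

/-- The extension of the three-curvature to the ambient space. -/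
def ambientCurvature (n : ℕ) (x : Mat n × (Fin n → Mat n)) :
    (Mat n × (Fin n → Mat n)) [⋀^Fin 3]→L[ℝ] ℂ :=
  (-(1 / (2 * Real.pi * Complex.I))) •
    (∑ k, oneWedge ((x.1 k k)⁻¹ • diagCLM k) (traceFormCLM k (x.2 k))) + extDeriv (ambientBeta n) x

theorem weylCurvature_eq (n : ℕ) :
    weylCurvature n = restrictForm (base n) (ambientCurvature n) := by
  funext x
  ext v
  simp only [weylCurvature, dBeta, restrictForm, ambientCurvature,
    ContinuousAlternatingMap.compContinuousLinearMap_apply, ContinuousAlternatingMap.add_apply,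
    ContinuousAlternatingMap.smul_apply, ContinuousAlternatingMap.sum_apply, oneWedge_apply]
  rfl

theorem contDiffAt_ambientCurvature {x : Mat n × (Fin n → Mat n)} (hx : x ∈ base n) :
    ContDiffAt ℝ ∞ (ambientCurvature n) x := by
  refine ContDiffAt.add ?_ (contDiffAt_extDeriv (contDiffAt_ambientBeta hx))
  refine contDiffAt_alternating fun v => ?_
  have h : (fun x : Mat n × (Fin n → Mat n) => ((-(1 / (2 * Real.pi * Complex.I))) •
      (∑ k, oneWedge ((x.1 k k)⁻¹ • diagCLM k) (traceFormCLM k (x.2 k)))) v) =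
      fun x => (-(1 / (2 * Real.pi * Complex.I))) * ∑ k, ∑ i : Fin 3, (-1) ^ i.val •
        ((x.1 k k)⁻¹ * (v i).1 k k * traceFormCLM k (x.2 k) (i.removeNth v)) := by
    funext x
    simp only [ContinuousAlternatingMap.smul_apply,
      ContinuousAlternatingMap.sum_apply, smul_eq_mul, oneWedge_apply]
    rfl
  rw [h]
  refine contDiffAt_const.mul (ContDiffAt.sum fun k _ => ContDiffAt.sum fun i _ => ?_)
  refine ContDiffAt.const_smul _ (ContDiffAt.mul (ContDiffAt.mul ?_ contDiffAt_const)
    (contDiffAt_traceFormCLM_apply k k x _))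
  exact (diagCLM k).contDiff.contDiffAt.inv (apply_ne_zero_of_mem_torus hx.1 k)

theorem isSmoothForm_weylCurvature (n : ℕ) : IsSmoothForm (weylCurvature n) :=
  weylCurvature_eq n ▸ isSmoothForm_restrictForm fun _ hx => contDiffAt_ambientCurvature hx

/-- The extension of the curving of the pull-back of the basic bundle gerbe to the ambient
space. -/
def ambientCurving (n : ℕ) (y : ℂ × (Mat n × (Fin n → Mat n))) :
    (ℂ × (Mat n × (Fin n → Mat n))) [⋀^Fin 2]→L[ℝ] ℂ :=
  (∑ k, ((-1 / (2 * Real.pi * Complex.I)) * logBranch y.1 (y.2.1 k k)) •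
    traceFormCLM k (y.2.2 k) + ambientBeta n y.2).compContinuousLinearMap
      (ContinuousLinearMap.snd ℝ ℂ (Mat n × (Fin n → Mat n)))

theorem ambientCurving_apply (y : ℂ × (Mat n × (Fin n → Mat n)))
    (v : Fin 2 → ℂ × (Mat n × (Fin n → Mat n))) :
    ambientCurving n y v = ∑ k, ((-1 / (2 * Real.pi * Complex.I)) * logBranch y.1 (y.2.1 k k)) *
      traceFormCLM k (y.2.2 k) (fun i => (v i).2) + ambientBeta n y.2 (fun i => (v i).2) := by
  simp only [ambientCurving, ContinuousAlternatingMap.compContinuousLinearMap_apply,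
    ContinuousAlternatingMap.add_apply, ContinuousAlternatingMap.smul_apply,
    ContinuousAlternatingMap.sum_apply, smul_eq_mul]
  rfl

theorem pulledCurving_eq_restrictForm (n : ℕ) :
    pulledCurving n = restrictForm (weylY n) (ambientCurving n) := by
  rw [pulledCurving_eq, beta_eq]
  funext y
  ext v
  simp only [restrictForm, SmoothMap.pullback, trPdPdP, ambientCurving_apply,
    ContinuousAlternatingMap.compContinuousLinearMap_apply, ContinuousAlternatingMap.add_apply,
    ContinuousAlternatingMap.smul_apply, ContinuousAlternatingMap.sum_apply, smul_eq_mul]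
  have h : ∀ i, (projBase n).tangentMap y (v i) = ⟨(v i).1.2, snd_mem_tangent y (v i)⟩ := fun i =>
    Subtype.ext (projBase_tangentMap y (v i))
  simp only [h, Function.comp_def]
  rfl

/-- The two logarithms defining `log_z ξ` have the same derivative in `z`, so the branch is locally
constant in `z`. The second one is differentiable because `1` is off the ray. -/
theorem hasFDerivAt_logBranch {z ξ : ℂ} (hz : z ≠ 0) (h1 : (1 : ℂ) ∉ ray z) (hξ : ξ ∉ ray z) :
    ∃ L : (ℂ × ℂ) →L[ℝ] ℂ, HasFDerivAt (fun q : ℂ × ℂ => logBranch q.1 q.2) L (z, ξ) ∧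
      ∀ w, L w = ξ⁻¹ * w.2 := by
  have hξ0 : ξ ≠ 0 := fun h => hξ (h ▸ zero_mem_ray z)
  have hf : HasFDerivAt (fun q : ℂ × ℂ => q.1) (ContinuousLinearMap.fst ℂ ℂ ℂ) (z, ξ) :=
    hasFDerivAt_fst
  have hs : HasFDerivAt (fun q : ℂ × ℂ => q.2) (ContinuousLinearMap.snd ℂ ℂ ℂ) (z, ξ) :=
    hasFDerivAt_snd
  have hi : HasFDerivAt (fun q : ℂ × ℂ => q.1⁻¹) _ (z, ξ) :=
    (hasDerivAt_inv hz).comp_hasFDerivAt (z, ξ) hf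
  have ha := (hs.neg.mul hi).clog (by
    have := neg_div_mem_slitPlane hz hξ
    rwa [div_eq_mul_inv] at this)
  have hb := (hi.const_mul (-1)).clog (by
    have := neg_div_mem_slitPlane hz h1
    rwa [div_eq_mul_inv] at this)
  have h := (ha.sub hb).restrictScalars ℝ
  refine ⟨_, h, fun w => ?_⟩
  simp
  field_simp
  ring

end Curvature

/-! ### The exterior derivative of the curving -/

section CurvingDerivative

theorem one_notMem_ray_of_mem_weylY {y : ℂ × (Mat n × (Fin n → Mat n))} (hy : y ∈ weylY n) :
    (1 : ℂ) ∉ ray y.1 :=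
  notMem_ray_of_norm_eq hy.2.1.1 norm_one hy.2.1.2

theorem contDiffAt_logBranch {z ξ : ℂ} (hz : z ≠ 0) (h1 : (1 : ℂ) ∉ ray z) (hξ : ξ ∉ ray z) :
    ContDiffAt ℝ ∞ (fun q : ℂ × ℂ => logBranch q.1 q.2) (z, ξ) := by
  have hf : ContDiffAt ℂ ∞ (fun q : ℂ × ℂ => q.1) (z, ξ) := contDiffAt_fst
  have hs : ContDiffAt ℂ ∞ (fun q : ℂ × ℂ => q.2) (z, ξ) := contDiffAt_snd
  have ha := ContDiffAt.comp (z, ξ) (Complex.contDiffAt_log (n := ∞)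
    (neg_div_mem_slitPlane hz hξ)) (hs.neg.div hf hz)
  have hb := ContDiffAt.comp (z, ξ) (Complex.contDiffAt_log (n := ∞)
    (neg_div_mem_slitPlane hz h1)) ((contDiffAt_const (c := (-1 : ℂ))).div hf hz)
  exact (ha.sub hb).restrict_scalars ℝ

/-- The pair `(z, p_k)` as a linear function on the ambient space. -/
def pairCLM (k : Fin n) : (ℂ × (Mat n × (Fin n → Mat n))) →L[ℝ] ℂ × ℂ :=
  (ContinuousLinearMap.fst ℝ ℂ (Mat n × (Fin n → Mat n))).prod
    ((diagCLM k).comp (ContinuousLinearMap.snd ℝ ℂ (Mat n × (Fin n → Mat n))))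

/-- The values of `tr(P_k dP_k dP_k)` as a linear function on the ambient space. -/
def traceValueCLM (k : Fin n) (w : Fin 2 → Mat n × (Fin n → Mat n)) :
    (ℂ × (Mat n × (Fin n → Mat n))) →L[ℝ] ℂ :=
  (ContinuousAlternatingMap.apply ℝ (Mat n × (Fin n → Mat n)) ℂ w ∘L traceFormCLM k ∘L
    projCLM k) ∘L ContinuousLinearMap.snd ℝ ℂ (Mat n × (Fin n → Mat n))

theorem contDiffAt_ambientCurving {y : ℂ × (Mat n × (Fin n → Mat n))} (hy : y ∈ weylY n) :
    ContDiffAt ℝ ∞ (ambientCurving n) y := by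
  refine contDiffAt_alternating fun v => ?_
  simp only [ambientCurving_apply]
  refine ContDiffAt.add (ContDiffAt.sum fun k _ => ContDiffAt.mul (contDiffAt_const.mul ?_)
    (traceValueCLM k fun i => (v i).2).contDiff.contDiffAt) ?_
  · have h := contDiffAt_logBranch (ne_zero_of_mem_weylY hy) (one_notMem_ray_of_mem_weylY hy)
      (notMem_ray_of_mem_weylY hy k)
    exact ContDiffAt.comp (f := pairCLM k) y h (pairCLM k).contDiff.contDiffAt
  · have h : ContDiffAt ℝ ∞ (fun y : ℂ × (Mat n × (Fin n → Mat n)) => ambientBeta n y.2) y :=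
      (contDiffAt_ambientBeta hy.1).comp y contDiffAt_snd
    exact ContDiffAt.alternating_apply h contDiffAt_const

/-- The product rule: differentiating the logarithm gives the wedge with `p_k⁻¹ dp_k`, and
differentiating `P_k` gives a term `log_z p_k tr(dP_k dP_k dP_k)`. -/
theorem fderiv_ambientCurving {y : ℂ × (Mat n × (Fin n → Mat n))} (hy : y ∈ weylY n)
    (w : Fin 2 → ℂ × (Mat n × (Fin n → Mat n))) (u : ℂ × (Mat n × (Fin n → Mat n))) :
    fderiv ℝ (fun y => ambientCurving n y w) y u =
      ∑ k, ((-1 / (2 * Real.pi * Complex.I)) * ((y.2.1 k k)⁻¹ * u.2.1 k k) *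
          traceFormCLM k (y.2.2 k) (fun i => (w i).2) +
        (-1 / (2 * Real.pi * Complex.I)) * logBranch y.1 (y.2.1 k k) *
          traceFormCLM k (u.2.2 k) (fun i => (w i).2)) +
      fderiv ℝ (fun x => ambientBeta n x (fun i => (w i).2)) y.2 u.2 := by
  choose L hL hL' using fun k => hasFDerivAt_logBranch (ne_zero_of_mem_weylY hy)
    (one_notMem_ray_of_mem_weylY hy) (notMem_ray_of_mem_weylY hy k)
  have hb : HasFDerivAt (fun x => ambientBeta n x (fun i => (w i).2)) _ y.2 :=
    ((ContDiffAt.alternating_apply (contDiffAt_ambientBeta hy.1)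
      (contDiffAt_const (c := fun i => (w i).2))).differentiableAt (by simp)).hasFDerivAt
  have hb' := hb.comp y (hasFDerivAt_snd (𝕜 := ℝ) (p := y))
  have hlog : ∀ k, HasFDerivAt (fun y : ℂ × (Mat n × (Fin n → Mat n)) =>
      logBranch y.1 (y.2.1 k k)) ((L k).comp (pairCLM k)) y := fun k =>
    HasFDerivAt.comp (f := pairCLM k) y (hL k) (pairCLM k).hasFDerivAt
  have hsum := HasFDerivAt.fun_sum (u := Finset.univ) fun k _ =>
    ((hlog k).const_mul (-1 / (2 * Real.pi * Complex.I))).mul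
      (traceValueCLM k fun i => (w i).2).hasFDerivAt
  have h := hsum.add hb'
  have hfun : (fun y => ambientCurving n y w) = fun y => ∑ k,
      ((-1 / (2 * Real.pi * Complex.I)) * logBranch y.1 (y.2.1 k k)) *
      traceFormCLM k (y.2.2 k) (fun i => (w i).2) + ambientBeta n y.2 (fun i => (w i).2) := by
    funext y
    rw [ambientCurving_apply]
  rw [hfun]
  refine (congrArg (fun l => l u) (HasFDerivAt.fderiv h)).trans ?_
  rw [add_apply, sum_apply]
  congr 1
  refine Finset.sum_congr rfl fun k _ => ?_
  change (-1 / (2 * Real.pi * Complex.I) * logBranch y.1 (y.2.1 k k)) *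
      traceFormCLM k (u.2.2 k) (fun i => (w i).2) + traceFormCLM k (y.2.2 k) (fun i => (w i).2) *
      (-1 / (2 * Real.pi * Complex.I) * L k (pairCLM k u)) = _
  rw [hL']
  change _ + _ * (_ * ((y.2.1 k k)⁻¹ * u.2.1 k k)) = _
  ring

/-- The alternating sum `tr(dP_k dP_k dP_k)` vanishes on tangent vectors. -/
theorem sum_traceFormCLM_eq_zero {x : Mat n × (Fin n → Mat n)} (hx : x ∈ base n)
    {v : Fin 3 → Mat n × (Fin n → Mat n)} (hv : ∀ i, v i ∈ tangent (base n) x) (k : Fin n) (i : Fin 3) :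
    traceFormCLM k ((v i).2 k) (i.removeNth v) = 0 := by
  have h : ∀ i, IsResolutionTangent x.2 (v i).2 := fun i => isResolutionTangent_of_mem (hv i)
  rw [traceFormCLM_apply]
  have hP := isResolution_of_mem hx.2
  simp only [Fin.removeNth]
  rw [(h _).trace_mul_mul hP (h _) (h _), (h _).trace_mul_mul hP (h _) (h _), sub_zero]

/-- On tangent vectors the terms still containing `log_z` carry a cubic trace and vanish, so the
derivative of the ambient extension agrees there with a form pulled back from the base. -/
theorem isExtDeriv_pulledCurving (n : ℕ) :
    IsExtDeriv (pulledCurving n) ((projBase n).pullback (weylCurvature n)) := by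
  have h := isExtDeriv_restrictForm (S := weylY n) fun _ hy => contDiffAt_ambientCurving hy
  rw [← pulledCurving_eq_restrictForm] at h
  have heq : (projBase n).pullback (weylCurvature n) =
      restrictForm (weylY n) (extDeriv (ambientCurving n)) := by
    rw [weylCurvature_eq]
    funext y
    ext v
    have ht : ∀ i, (projBase n).tangentMap y (v i) = ⟨(v i).1.2, snd_mem_tangent y (v i)⟩ :=
      fun i => Subtype.ext (projBase_tangentMap y (v i))
    have hA : (projBase n).pullback (restrictForm (base n) (ambientCurvature n)) y v =
        ambientCurvature n y.1.2 (fun i => (v i).1.2) := by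
      simp only [restrictForm, SmoothMap.pullback,
        ContinuousAlternatingMap.compContinuousLinearMap_apply, ht, Function.comp_def]
      rfl
    have hB : restrictForm (weylY n) (extDeriv (ambientCurving n)) y v =
        extDeriv (ambientCurving n) y.1 (fun i => (v i).1) := rfl
    rw [hA, hB, extDeriv_apply ((contDiffAt_ambientCurving y.2).differentiableAt (by simp))]
    simp only [fderiv_ambientCurving y.2]
    have hz : ∀ k (i : Fin 3), traceFormCLM k ((v i).1.2.2 k)
        (fun j => (i.removeNth (fun i => (v i).1) j).2) = 0 := fun k i =>
      sum_traceFormCLM_eq_zero (v := fun i => (v i).1.2) y.2.1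
        (fun i => snd_mem_tangent y (v i)) k i
    simp only [hz, mul_zero, add_zero, smul_add, Finset.sum_add_distrib]
    simp only [ambientCurvature, ContinuousAlternatingMap.add_apply,
      ContinuousAlternatingMap.smul_apply, ContinuousAlternatingMap.sum_apply, oneWedge_apply]
    congr 1
    · simp only [Finset.smul_sum]
      -- The exterior derivative sums over argument slots on the outside, the curvature over `k`.
      rw [Finset.sum_comm]
      refine Finset.sum_congr rfl fun i _ => Finset.sum_congr rfl fun k _ => ?_
      rw [smul_comm]
      congr 1
      rw [smul_eq_mul, ← mul_assoc, neg_div]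
      rfl
    · rw [extDeriv_apply ((contDiffAt_ambientBeta y.2.1).differentiableAt (by simp))]
      rfl
  rw [heq]
  exact h

theorem isSmoothForm_pulledCurving (n : ℕ) : IsSmoothForm (pulledCurving n) :=
  pulledCurving_eq_restrictForm n ▸ isSmoothForm_restrictForm fun _ hy => contDiffAt_ambientCurving hy

end CurvingDerivative

/-! ### Smoothness of matrix operations -/

section Smooth

variable {E : Type*} [NormedAddCommGroup E] [NormedSpace ℝ E]

theorem contDiff_matrix {f : E → Mat n} (h : ∀ i j, ContDiff ℝ ∞ fun u => f u i j) :
    ContDiff ℝ ∞ f :=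
  contDiff_pi.2 fun i => contDiff_pi.2 fun j => h i j

theorem ContDiff.matrix_apply {f : E → Mat n} (h : ContDiff ℝ ∞ f) (i j : Fin n) :
    ContDiff ℝ ∞ fun u => f u i j :=
  (entryCLM i j).contDiff.comp h

theorem ContDiff.matrix_mul {f g : E → Mat n} (hf : ContDiff ℝ ∞ f) (hg : ContDiff ℝ ∞ g) :
    ContDiff ℝ ∞ fun u => f u * g u :=
  (mulCLM n).isBoundedBilinearMap.contDiff.comp (hf.prodMk hg)

theorem ContDiff.matrix_star {f : E → Mat n} (hf : ContDiff ℝ ∞ f) :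
    ContDiff ℝ ∞ fun u => star (f u) :=
  contDiff_matrix fun i j => Complex.conjCLE.contDiff.comp (ContDiff.matrix_apply hf j i)

theorem ContDiff.matrix_det {f : E → Mat n} (hf : ContDiff ℝ ∞ f) :
    ContDiff ℝ ∞ fun u => (f u).det := by
  simp only [Matrix.det_apply]
  exact ContDiff.sum fun σ _ => (contDiff_prod fun i _ => ContDiff.matrix_apply hf _ _).const_smul _

theorem ContDiff.matrix_inv {f : E → Mat n} (hf : ContDiff ℝ ∞ f) (h0 : ∀ u, (f u).det ≠ 0) :
    ContDiff ℝ ∞ fun u => (f u)⁻¹ := by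
  simp only [Matrix.inv_def, Ring.inverse_eq_inv']
  -- Cramer's rule: the entries of the adjugate are determinants with one row replaced.
  have had : ContDiff ℝ ∞ fun u => (f u).adjugate := by
    refine contDiff_matrix fun i j => ?_
    simp only [Matrix.adjugate_apply]
    refine ContDiff.matrix_det (contDiff_matrix fun k l => ?_)
    simp only [Matrix.updateRow_apply]
    split_ifs
    · exact contDiff_const
    · exact ContDiff.matrix_apply hf k l
  exact ContDiff.smul ((ContDiff.matrix_det hf).inv h0) had

theorem HasDerivAt.matrix_mul {f g : ℝ → Mat n} {f' g' : Mat n} {s : ℝ} (hf : HasDerivAt f f' s)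
    (hg : HasDerivAt g g' s) : HasDerivAt (fun s => f s * g s) (f s * g' + f' * g s) s :=
  (mulCLM n).hasDerivAt_of_bilinear (fun _ => hf) (fun _ => hg)

theorem HasDerivAt.matrix_star {f : ℝ → Mat n} {f' : Mat n} {s : ℝ} (hf : HasDerivAt f f' s) :
    HasDerivAt (fun s => star (f s)) (star f') s := by
  refine hasDerivAt_pi.2 fun i => hasDerivAt_pi.2 fun j => ?_
  have h := (Complex.conjCLE : ℂ →L[ℝ] ℂ).hasFDerivAt.comp_hasDerivAt s
    ((entryCLM j i).hasFDerivAt.comp_hasDerivAt s hf)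
  exact h

end Smooth

/-! ### Unitary matrices from skew-Hermitian ones -/

section Cayley

/-- The Cayley transform. -/
def cayley (B : Mat n) : Mat n := (1 + B) * (1 - B)⁻¹

/-- For skew-Hermitian `B`, the product `(1 + B) * (1 - B)` is the positive definite matrix `1 + B*
B`. Hence the Cayley transform is smooth on all skew-Hermitian matrices. -/
theorem det_one_sub_ne_zero {B : Mat n} (hB : star B = -B) : (1 - B).det ≠ 0 := by
  open scoped ComplexOrder in
  have h1 : (1 + star B * B).PosDef :=
    Matrix.PosDef.one.add_posSemidef (Matrix.posSemidef_conjTranspose_mul_self B)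
  have h2 : (1 + star B * B) = (1 + B) * (1 - B) := by
    rw [hB]
    noncomm_ring
  intro h0
  have h3 := (Matrix.isUnit_iff_isUnit_det _).1 h1.isUnit
  rw [h2, Matrix.det_mul, h0, mul_zero] at h3
  exact not_isUnit_zero h3

theorem star_cayley_mul_cayley {B : Mat n} (hB : star B = -B) : star (cayley B) * cayley B = 1 := by
  have h1 : IsUnit (1 - B).det := isUnit_iff_ne_zero.2 (det_one_sub_ne_zero hB)
  have h2 : star ((1 - B)⁻¹) = (1 + B)⁻¹ := by
    rw [Matrix.star_eq_conjTranspose, Matrix.conjTranspose_nonsing_inv,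
      ← Matrix.star_eq_conjTranspose, star_sub, star_one, hB, sub_neg_eq_add]
  have h3 : IsUnit (1 + B).det := by
    have := det_one_sub_ne_zero (B := -B) (by rw [star_neg, hB])
    rw [sub_neg_eq_add] at this
    exact isUnit_iff_ne_zero.2 this
  have hc : (1 - B) * (1 + B) = (1 + B) * (1 - B) := by noncomm_ring
  have h4 : star (1 + B) = 1 - B := by rw [star_add, star_one, hB, sub_eq_add_neg]
  rw [cayley, star_mul, h2, h4, mul_assoc, ← mul_assoc (1 - B) (1 + B), hc, mul_assoc (1 + B),
    Matrix.mul_nonsing_inv _ h1, mul_one, Matrix.nonsing_inv_mul _ h3]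

theorem contDiff_cayley {E : Type*} [NormedAddCommGroup E] [NormedSpace ℝ E] {f : E → Mat n}
    (hf : ContDiff ℝ ∞ f) (hs : ∀ u, star (f u) = -f u) : ContDiff ℝ ∞ fun u => cayley (f u) :=
  ContDiff.matrix_mul (contDiff_const.add hf)
    (ContDiff.matrix_inv (contDiff_const.sub hf) fun u => det_one_sub_ne_zero (hs u))

/-- The derivative of the Cayley transform at zero is `B ↦ 2B`, whence the factor `1 / 2`. -/
theorem hasDerivAt_cayley {A : Mat n} (hA : star A = -A) :
    HasDerivAt (fun s : ℝ => cayley (s • ((1 / 2 : ℝ) • A))) A 0 := by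
  have hs : ∀ s : ℝ, star (s • ((1 / 2 : ℝ) • A)) = -(s • ((1 / 2 : ℝ) • A)) := by
    intro s
    rw [star_smul, star_smul, hA]
    simp
  have hlin : HasDerivAt (fun s : ℝ => s • ((1 / 2 : ℝ) • A)) ((1 / 2 : ℝ) • A) 0 := by
    simpa using (hasDerivAt_id (0 : ℝ)).smul_const ((1 / 2 : ℝ) • A)
  have hc : ContDiff ℝ ∞ fun s : ℝ => cayley (s • ((1 / 2 : ℝ) • A)) :=
    contDiff_cayley (contDiff_id.smul contDiff_const) hs
  have hd := (hc.differentiable (by simp) 0).hasDerivAt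
  set D := deriv (fun s : ℝ => cayley (s • ((1 / 2 : ℝ) • A))) 0
  have h1 := HasDerivAt.matrix_mul hd (hlin.const_sub 1)
  -- Differentiating `cayley B * (1 - B) = 1 + B` avoids a formula for the derivative of the
  -- inverse.
  have h2 : (fun s : ℝ => cayley (s • ((1 / 2 : ℝ) • A)) * (1 - s • ((1 / 2 : ℝ) • A))) =
      fun s => 1 + s • ((1 / 2 : ℝ) • A) := by
    funext s
    rw [cayley, mul_assoc, Matrix.nonsing_inv_mul _
      (isUnit_iff_ne_zero.2 (det_one_sub_ne_zero (hs s))), mul_one]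
  rw [h2] at h1
  have h3 := h1.unique (hlin.const_add 1)
  have h4 : D = A := by
    simp only [zero_smul, sub_zero, mul_one, cayley, add_zero, inv_one, one_mul] at h3
    rw [eq_add_of_neg_add_eq h3, ← add_smul]
    norm_num
  rwa [h4] at hd

end Cayley

/-! ### Parametrisations with prescribed partial derivatives -/

section Parametrisation

/-- Only unitarity is required, so conjugation by Cayley transforms is allowed although their
determinants need not be one. -/
theorem conj_mem_projTuples {P : Fin n → Mat n} (hP : P ∈ projTuples n) {U : Mat n}
    (hU : star U * U = 1) : (fun k => U * P k * star U) ∈ projTuples n := by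
  have hmul : ∀ i j, U * P i * star U * (U * P j * star U) = U * (P i * P j) * star U := by
    intro i j
    calc _ = U * P i * (star U * U) * P j * star U := by simp only [mul_assoc]
      _ = _ := by rw [hU]; simp only [mul_one, mul_assoc]
  refine ⟨fun i => ⟨?_, ?_, ?_⟩, fun i j hij => ?_⟩
  · have := (hP.1 i).1.eq
    simp [Matrix.IsHermitian, Matrix.star_eq_conjTranspose, mul_assoc, this]
  · rw [hmul, (hP.1 i).2.1]
  · have hu1 : IsUnit U.det := (Matrix.isUnit_iff_isUnit_det U).1 (IsUnit.of_mul_eq_one_right _ hU)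
    have hu2 : IsUnit (star U).det :=
      (Matrix.isUnit_iff_isUnit_det _).1 (IsUnit.of_mul_eq_one _ hU)
    rw [Matrix.rank_mul_eq_left_of_isUnit_det _ _ hu2,
      Matrix.rank_mul_eq_right_of_isUnit_det _ _ hu1, (hP.1 i).2.2]
  · rw [hmul, hP.2 i j hij, mul_zero, zero_mul]

/-- The generator of the rotation of a tuple of projections. -/
def generator (P Q : Fin n → Mat n) : Mat n := ∑ k, Q k * P k

/-- The sum of the generator and its adjoint is `∑ (P_k Q_k + Q_k P_k) = ∑ Q_k = 0`. -/
theorem IsResolutionTangent.star_generator {P Q : Fin n → Mat n} (hQ : IsResolutionTangent P Q)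
    (hP' : ∀ k, (P k).IsHermitian) (hQ' : ∀ k, (Q k).IsHermitian) :
    star (generator P Q) = -generator P Q := by
  rw [eq_neg_iff_add_eq_zero, generator, star_sum, ← Finset.sum_add_distrib, ← hQ.sum_eq]
  refine Finset.sum_congr rfl fun k _ => ?_
  have h := hQ.mul_add_mul k k
  rw [if_pos rfl] at h
  rw [star_mul, Matrix.star_eq_conjTranspose, Matrix.star_eq_conjTranspose, (hP' k).eq,
    (hQ' k).eq, add_comm, h]

/-- Conjugation by a unitary curve through `1` with velocity `generator P Q` therefore moves each `P
j` with velocity `Q j`. -/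
theorem IsResolutionTangent.generator_commutator {P Q : Fin n → Mat n}
    (hQ : IsResolutionTangent P Q) (hP : IsResolution P) (j : Fin n) :
    generator P Q * P j - P j * generator P Q = Q j := by
  have h1 : generator P Q * P j = Q j * P j := by
    rw [generator, Finset.sum_mul]
    simp [mul_assoc, hP.mul_eq]
  have h2 : P j * generator P Q = Q j * P j - Q j := by
    have h3 : ∀ k, P j * (Q k * P k) = (if j = k then Q j * P j else 0) - Q j * P k := by
      intro k
      have h := hQ.mul_add_mul j k
      have h' := congrArg (· * P k) h
      simp only [add_mul, mul_assoc, hP.mul_eq, if_true] at h'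
      rw [eq_sub_iff_add_eq, add_comm, h']
      split_ifs with hjk
      · subst hjk; rfl
      · rw [zero_mul]
    rw [generator, Finset.mul_sum, Finset.sum_congr rfl fun k _ => h3 k, Finset.sum_sub_distrib,
      ← Finset.mul_sum, hP.sum_eq, mul_one]
    simp only [Finset.sum_ite_eq, Finset.mem_univ, if_true]
  rw [h1, h2, sub_sub_cancel]

variable {x : Mat n × (Fin n → Mat n)}

/-- Tangent vectors to `T × SU(n)/T` are the partial derivatives of a parametrisation. -/
theorem exists_plot_base (hx : x ∈ base n) {m : ℕ} (v : Fin m → Mat n × (Fin n → Mat n))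
    (hv : ∀ a, v a ∈ tangent (base n) x) :
    ∃ φ : Plot (base n) m, φ.toFun 0 = x ∧
      ∀ a, fderiv ℝ φ.toFun 0 (EuclideanSpace.single a 1) = v a := by
  have hP := isResolution_of_mem hx.2
  have hQ : ∀ a, IsResolutionTangent x.2 (v a).2 := fun a => isResolutionTangent_of_mem (hv a)
  set A : Fin m → Mat n := fun a => generator x.2 (v a).2 with hAdef
  have hA : ∀ a, star (A a) = -A a := fun a =>
    (hQ a).star_generator (fun k => (hx.2.1 k).1) (isHermitian_of_mem_tangent (hv a))
  set w : Fin m → Fin n → ℂ := fun a k => (v a).1 k k * (x.1 k k)⁻¹ with hw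
  have hx0 : ∀ k, x.1 k k ≠ 0 := apply_ne_zero_of_mem_torus hx.1
  -- The logarithmic velocities are imaginary and have zero sum, which keeps the exponentials below
  -- of modulus one and with product one.
  have hwre : ∀ a k, (w a k).re = 0 := by
    intro a k
    have h1 := star_mul_add_of_mem_tangent (hv a) k
    have h2 : (x.1 k k)⁻¹ = star (x.1 k k) := by
      rw [Complex.inv_def, Complex.normSq_eq_norm_sq, norm_apply_of_mem_torus hx.1 k]
      simp
    have h3 : w a k + (starRingEnd ℂ) (w a k) = 0 := by
      rw [← h1, hw]
      simp only [h2, starRingEnd_apply, star_mul, star_star]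
      ring
    rw [Complex.add_conj] at h3
    simpa using h3
  have hwsum : ∀ a, ∑ k, w a k = 0 := fun a => sum_div_of_mem_tangent hx (hv a)
  let B : EuclideanSpace ℝ (Fin m) → Mat n := fun u => ∑ a, u a • ((1 / 2 : ℝ) • A a)
  have hB : ∀ u, star (B u) = -B u := by
    intro u
    simp only [B, star_sum, star_smul, hA, smul_neg, Finset.sum_neg_distrib, star_trivial]
  let W : EuclideanSpace ℝ (Fin m) → Fin n → ℂ := fun u k => ∑ a, (u a : ℂ) * w a k
  -- The torus entries move by exponentials of linear functions, the projections by conjugation with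
  -- the Cayley transform of a linear family of generators.
  let f : EuclideanSpace ℝ (Fin m) → Mat n × (Fin n → Mat n) := fun u =>
    (Matrix.diagonal fun k => x.1 k k * Complex.exp (W u k),
      fun k => cayley (B u) * x.2 k * star (cayley (B u)))
  have hcoord : ∀ a, ContDiff ℝ ∞ fun u : EuclideanSpace ℝ (Fin m) => u a := fun a => by fun_prop
  have hWc : ∀ k, ContDiff ℝ ∞ fun u => W u k := fun k =>
    ContDiff.sum fun a _ => (Complex.ofRealCLM.contDiff.comp (hcoord a)).mul contDiff_const
  have hBc : ContDiff ℝ ∞ B := ContDiff.sum fun a _ => (hcoord a).smul contDiff_const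
  have hUc : ContDiff ℝ ∞ fun u => cayley (B u) := contDiff_cayley hBc hB
  have hfc : ContDiff ℝ ∞ f := by
    refine ContDiff.prodMk (contDiff_matrix fun i j => ?_) (contDiff_pi.2 fun k => ?_)
    · simp only [Matrix.diagonal_apply]
      split_ifs
      · exact contDiff_const.mul (hWc i).cexp
      · exact contDiff_const
    · exact ContDiff.matrix_mul (ContDiff.matrix_mul hUc contDiff_const) (ContDiff.matrix_star hUc)
  have hnorm : ∀ u k, star (x.1 k k * Complex.exp (W u k)) * (x.1 k k * Complex.exp (W u k)) = 1 := by
    intro u k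
    have h1 : (W u k).re = 0 := by simp [W, hwre]
    have h2 : ‖x.1 k k * Complex.exp (W u k)‖ = 1 := by
      rw [norm_mul, norm_apply_of_mem_torus hx.1 k, Complex.norm_exp, h1, Real.exp_zero, mul_one]
    have h3 := Complex.conj_mul' (x.1 k k * Complex.exp (W u k))
    rw [h2] at h3
    simpa using h3
  have hWsum : ∀ u, ∑ k, W u k = 0 := by
    intro u
    simp only [W]
    rw [Finset.sum_comm]
    simp [← Finset.mul_sum, hwsum]
  have hmem : ∀ u, f u ∈ base n := by
    intro u
    refine ⟨⟨⟨Matrix.mem_unitaryGroup_iff'.2 ?_, ?_⟩, Matrix.isDiag_diagonal _⟩,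
      conj_mem_projTuples hx.2 (star_cayley_mul_cayley (hB u))⟩
    · rw [Matrix.star_eq_conjTranspose, Matrix.diagonal_conjTranspose,
        Matrix.diagonal_mul_diagonal, ← Matrix.diagonal_one]
      congr 1
      funext k
      exact hnorm u k
    · change (Matrix.diagonal fun k => x.1 k k * Complex.exp (W u k)).det = 1
      rw [Matrix.det_diagonal, Finset.prod_mul_distrib, prod_apply_of_mem_torus hx.1,
        ← Complex.exp_sum, hWsum, Complex.exp_zero, one_mul]
  have hB0 : B 0 = 0 := by simp [B]
  have hf0 : f 0 = x := by
    refine Prod.ext ?_ (funext fun k => ?_)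
    · have : ∀ k, W 0 k = 0 := fun k => by simp [W]
      simp only [f, this, Complex.exp_zero, mul_one]
      exact hx.1.2.diagonal_diag
    · simp [f, hB0, cayley]
  refine ⟨⟨f, hfc, hmem⟩, hf0, fun a => ?_⟩
  have hline : HasDerivAt (fun s : ℝ => s • EuclideanSpace.single (𝕜 := ℝ) a (1 : ℝ))
      (EuclideanSpace.single a 1) 0 := by
    simpa using (hasDerivAt_id (0 : ℝ)).smul_const (EuclideanSpace.single (𝕜 := ℝ) a (1 : ℝ))
  have hd : HasFDerivAt f (fderiv ℝ f 0) ((0 : ℝ) • EuclideanSpace.single (𝕜 := ℝ) a (1 : ℝ)) := by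
    rw [zero_smul]
    exact (hfc.differentiable (by simp) 0).hasFDerivAt
  have h1 := hd.comp_hasDerivAt (0 : ℝ) hline
  have hBl : ∀ s : ℝ, B (s • EuclideanSpace.single a 1) = s • ((1 / 2 : ℝ) • A a) := by
    intro s
    simp only [B, PiLp.smul_apply, PiLp.single_apply, smul_eq_mul]
    rw [Finset.sum_eq_single a (fun b _ hb => by rw [if_neg hb, mul_zero, zero_smul])
      (fun h => absurd (Finset.mem_univ a) h), if_pos rfl, mul_one]
  have hWl : ∀ (s : ℝ) k, W (s • EuclideanSpace.single a 1) k = s * w a k := by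
    intro s k
    simp only [W, PiLp.smul_apply, PiLp.single_apply, smul_eq_mul]
    rw [Finset.sum_eq_single a (fun b _ hb => by rw [if_neg hb]; simp)
      (fun h => absurd (Finset.mem_univ a) h), if_pos rfl, mul_one]
  have hU := hasDerivAt_cayley (hA a)
  have h2 : HasDerivAt (f ∘ fun s : ℝ => s • EuclideanSpace.single (𝕜 := ℝ) a (1 : ℝ)) (v a) 0 := by
    refine HasDerivAt.prodMk (f₁' := (v a).1) (f₂' := (v a).2) ?_ (hasDerivAt_pi.2 fun k => ?_)
    · refine hasDerivAt_pi.2 fun i => hasDerivAt_pi.2 fun j => ?_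
      simp only [hWl, Matrix.diagonal_apply]
      by_cases hij : i = j
      · subst hij
        simp only [if_true]
        have h3 : HasDerivAt (fun s : ℝ => (s : ℂ) * w a i) (1 * w a i) 0 :=
          (Complex.ofRealCLM.hasDerivAt (x := (0 : ℝ))).mul_const (w a i)
        have h4 := h3.cexp.const_mul (x.1 i i)
        convert! h4 using 1
        simp only [hw, Complex.ofReal_zero, zero_mul, Complex.exp_zero, one_mul]
        field_simp [hx0 i]
      · simp only [if_neg hij]
        rw [isDiag_of_mem_tangent (hv a) hij]
        exact hasDerivAt_const _ _
    · simp only [hBl]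
      have h3 := HasDerivAt.matrix_mul (HasDerivAt.matrix_mul hU (hasDerivAt_const _ (x.2 k)))
        (HasDerivAt.matrix_star hU)
      convert! h3 using 1
      rw [← (hQ a).generator_commutator hP k, hA]
      simp [cayley, sub_eq_neg_add, hAdef]
  exact h1.unique h2

/-- Parametrisations are defined on all of `ℝᵐ`, so one is localised by composing it with a map into
a small ball, at the cost of a positive factor in the derivative at `0`. -/
theorem exists_radius {S : Set (Mat n × (Fin n → Mat n))} {m : ℕ} (φ : Plot S m)
    {U : Set (Mat n × (Fin n → Mat n))} (hU : IsOpen U) (h0 : φ.toFun 0 ∈ U) :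
    ∃ r : ℝ, 0 < r ∧ ∃ φ' : Plot S m, φ'.toFun 0 = φ.toFun 0 ∧ (∀ u, φ'.toFun u ∈ U) ∧
      fderiv ℝ φ'.toFun 0 = r • fderiv ℝ φ.toFun 0 := by
  obtain ⟨r, hr, hball⟩ := Metric.mem_nhds_iff.1
    ((hU.preimage φ.contDiff.continuous).mem_nhds h0)
  -- Smooth, with values in the ball of radius `r` since `‖u‖ < 1 + ‖u‖ ^ 2`, and with derivative `r
  -- • id` at the origin.
  let ρ : EuclideanSpace ℝ (Fin m) → EuclideanSpace ℝ (Fin m) := fun u => (r / (1 + ‖u‖ ^ 2)) • u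
  have hpos : ∀ u : EuclideanSpace ℝ (Fin m), 0 < 1 + ‖u‖ ^ 2 := fun u => by positivity
  have hc : ContDiff ℝ ∞ fun u : EuclideanSpace ℝ (Fin m) => r / (1 + ‖u‖ ^ 2) :=
    contDiff_const.div (contDiff_const.add (contDiff_norm_sq ℝ)) fun u => (hpos u).ne'
  have hρ : ContDiff ℝ ∞ ρ := hc.smul contDiff_id
  have hρ0 : ρ 0 = 0 := by simp [ρ]
  have hρU : ∀ u, ρ u ∈ Metric.ball 0 r := by
    intro u
    rw [mem_ball_zero_iff, norm_smul, Real.norm_of_nonneg (div_pos hr (hpos u)).le,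
      div_mul_eq_mul_div, div_lt_iff₀ (hpos u)]
    nlinarith [sq_nonneg (‖u‖ - 1), norm_nonneg u]
  have hρd : HasFDerivAt ρ (r • ContinuousLinearMap.id ℝ (EuclideanSpace ℝ (Fin m))) 0 := by
    have h := ((hc.differentiable (by simp) 0).hasFDerivAt).smul (hasFDerivAt_id (𝕜 := ℝ)
      (0 : EuclideanSpace ℝ (Fin m)))
    convert! h using 1
    ext u
    simp
  refine ⟨r, hr, ⟨φ.toFun ∘ ρ, φ.contDiff.comp hρ, fun u => φ.mem _⟩, by simp [hρ0],
    fun u => hball (hρU u), ?_⟩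
  have hφ : HasFDerivAt φ.toFun (fderiv ℝ φ.toFun 0) (ρ 0) := by
    rw [hρ0]
    exact (φ.contDiff.differentiable (by simp) 0).hasFDerivAt
  refine (hφ.comp 0 hρd).fderiv.trans ?_
  ext u <;> simp

theorem exists_norm_eq_one_notMem (s : Finset ℂ) : ∃ z : ℂ, ‖z‖ = 1 ∧ z ∉ s := by
  have h1 : IsPreconnected (Metric.sphere (0 : ℂ) 1) :=
    isPreconnected_sphere (by simp [Complex.rank_real_complex]) 0 1
  have h2 : (Metric.sphere (0 : ℂ) 1).Infinite :=
    h1.infinite_of_nontrivial ⟨1, by simp, -1, by simp, by norm_num⟩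
  obtain ⟨z, hz, hzs⟩ := h2.exists_notMem_finset s
  exact ⟨z, by simpa using hz, hzs⟩

end Parametrisation

/-! ### Uniqueness and the pull-back by the Weyl map -/

section Uniqueness

/-- The image of a parametrisation under a smooth map. -/
def Plot.map {V W : Type*} [NormedAddCommGroup V] [NormedSpace ℝ V] [NormedAddCommGroup W]
    [NormedSpace ℝ W] {S : Set V} {S' : Set W} {m : ℕ} (φ : Plot S m) (F : SmoothMap S S') :
    Plot S' m where
  toFun := F.toFun ∘ φ.toFun
  contDiff := F.contDiff.comp φ.contDiff
  mem u := F.mapsTo _ (φ.mem u)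

theorem Plot.pullback_map {V W : Type*} [NormedAddCommGroup V] [NormedSpace ℝ V]
    [NormedAddCommGroup W] [NormedSpace ℝ W] {S : Set V} {S' : Set W} {m k : ℕ} (φ : Plot S m)
    (F : SmoothMap S S') (α : DiffForm S' k) :
    (φ.map F).pullback α = φ.pullback (F.pullback α) := by
  funext u
  ext v
  refine congrArg (α ⟨F.toFun (φ.toFun u), F.mapsTo _ (φ.mem u)⟩) (funext fun i => Subtype.ext ?_)
  have h := fderiv_comp u (F.contDiff.differentiable (by simp) (φ.toFun u))
    (φ.contDiff.differentiable (by simp) u)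
  exact congrArg (fun l => l (v i)) h

/-- Tangent spaces at equal points are different types, so the arguments are compared as ambient
vectors. -/
theorem DiffForm.apply_congr {V : Type*} [NormedAddCommGroup V] [NormedSpace ℝ V] {S : Set V}
    {k : ℕ} (α : DiffForm S k) {x x' : S} (hx : x.1 = x'.1) {v : Fin k → tangent S x.1}
    {v' : Fin k → tangent S x'.1} (hv : ∀ i, (v i).1 = (v' i).1) : α x v = α x' v' := by
  obtain rfl : x = x' := Subtype.ext hx
  exact congrArg (α x) (funext fun i => Subtype.ext (hv i))

/-- Three-forms on `T × SU(n)/T` are determined by their pull-backs to `Y_T × SU(n)/T`. -/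
theorem eq_of_pullback_projBase {α α' : DiffForm (base n) 3}
    (h : ∀ (ψ : Plot (weylY n) 3) (u : EuclideanSpace ℝ (Fin 3)),
      ψ.pullback ((projBase n).pullback α) u = ψ.pullback ((projBase n).pullback α') u) :
    α = α' := by
  funext x
  ext v
  obtain ⟨φ, hφ0, hφd⟩ := exists_plot_base x.2 (fun a => (v a).1) fun a => (v a).2
  -- A `z` that is neither `1` nor an eigenvalue at `x` stays admissible nearby, so keeping it
  -- constant gives a local section of the submersion.
  obtain ⟨z, hz1, hz⟩ := exists_norm_eq_one_notMem (insert 1 (Finset.univ.image fun k => x.1.1 k k))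
  rw [Finset.mem_insert, not_or] at hz
  let U : Set (Mat n × (Fin n → Mat n)) := ⋂ k, {w | diagCLM k w ≠ z}
  have hU : IsOpen U := isOpen_iInter_of_finite fun k =>
    isOpen_ne_fun (diagCLM k).continuous continuous_const
  have hxU : φ.toFun 0 ∈ U := by
    rw [hφ0]
    refine mem_iInter.2 fun k hk => hz.2 ?_
    exact Finset.mem_image.2 ⟨k, Finset.mem_univ k, hk⟩
  obtain ⟨r, hr, φ', h0, hφU, hd⟩ := exists_radius φ hU hxU
  let ψ : Plot (weylY n) 3 :=
    ⟨fun u => (z, φ'.toFun u), contDiff_const.prodMk φ'.contDiff, fun u =>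
      ⟨φ'.mem u, ⟨hz1, hz.1⟩, fun k hk => mem_iInter.1 (hφU u) k hk.symm⟩⟩
  -- Localising rescaled each of the three partial derivatives by `r`, so the value at `v` is seen
  -- up to the nonzero factor `r³`.
  have key : ∀ α : DiffForm (base n) 3, ψ.pullback ((projBase n).pullback α) 0
      (fun a => EuclideanSpace.single a 1) = (∏ _a : Fin 3, r) • α x v := by
    intro α
    rw [← Plot.pullback_map, ← ContinuousAlternatingMap.map_smul_univ]
    refine DiffForm.apply_congr α (h0.trans hφ0) fun a => ?_
    change fderiv ℝ φ'.toFun 0 (EuclideanSpace.single a 1) = r • (v a).1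
    rw [hd, ← hφd a]
    rfl
  have h1 := congrArg (fun σ => σ fun a => EuclideanSpace.single a 1) (h ψ 0)
  simp only [key] at h1
  exact smul_right_injective ℂ (Finset.prod_ne_zero_iff.2 fun _ _ => hr.ne') h1

theorem isExtDeriv_beta_iff (η : DiffForm (base n) 3) : IsExtDeriv (beta n) η ↔ η = dBeta n := by
  refine ⟨fun h => eq_of_pullback_projBase fun ψ u => ?_, fun h => h ▸ isExtDeriv_beta n⟩
  rw [← Plot.pullback_map, ← Plot.pullback_map]
  exact (h 3 _ u).symm.trans (isExtDeriv_beta n 3 _ u)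

theorem eq_weylCurvature {η : DiffForm (base n) 3}
    (h : IsExtDeriv (pulledCurving n) ((projBase n).pullback η)) : η = weylCurvature n :=
  eq_of_pullback_projBase fun ψ u => (h 3 ψ u).symm.trans (isExtDeriv_pulledCurving n 3 ψ u)

theorem isThreeCurvature_pulledCurving_iff (η : DiffForm (base n) 3) :
    IsThreeCurvature (projBase n) (pulledCurving n) η ↔ η = weylCurvature n :=
  ⟨fun h => eq_weylCurvature h.2,
    fun h => h ▸ ⟨isSmoothForm_weylCurvature n, isExtDeriv_pulledCurving n⟩⟩

/-- The Weyl map after `projBase` and `basicProj` after `weylLift` are the same map. Pulling `df_b`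
back along the lift therefore shows that `p^*ω_b` satisfies the equation that determines the
three-curvature. -/
theorem pullback_weyl_eq {η : DiffForm (SU n) 3}
    (h : IsThreeCurvature (basicProj n) (basicCurving n) η) :
    (weyl n).pullback η = weylCurvature n := by
  refine eq_weylCurvature fun m ψ u => ?_
  have h1 := h.2 m (ψ.map (weylLift n)) u
  rw [Plot.pullback_map, ← Plot.pullback_map (ψ.map (weylLift n))] at h1
  rw [← Plot.pullback_map, ← Plot.pullback_map]
  exact h1

end Uniqueness

end

end WeylGerbe

open WeylGerbe
theorem proposition5p11 (n : ℕ) :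
    -- `β` and `f_{p^*b}` are smooth forms on `T × SU(n)/T` and on `Y_T × SU(n)/T`
    IsSmoothForm (beta n) ∧ IsSmoothForm (pulledCurving n) ∧
    -- the curving `f_{p^*b}`
    (pulledCurving n = fun y =>
      (∑ k, ((-1 / (2 * Real.pi * Complex.I)) *
          logBranch y.1.1 (p k ((projBase n).onPoint y))) •
        (projBase n).pullback (trPdPdP k k) y) +
      (projBase n).pullback (beta n) y) ∧
    -- the form `dβ`
    ∃ dbeta : DiffForm (base n) 3,
      (∀ η : DiffForm (base n) 3, IsExtDeriv (beta n) η ↔ η = dbeta) ∧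
      -- the three-curvature of `f_{p^*b}`
      (∀ η : DiffForm (base n) 3, IsThreeCurvature (projBase n) (pulledCurving n) η ↔
        η = fun x => (-(1 / (2 * Real.pi * Complex.I))) •
          (∑ k, oneWedge ((p k x)⁻¹ • dp k x) (trPdPdP k k x)) + dbeta x) ∧
      -- the same form is the pull-back of the three-curvature of the basic bundle gerbe
      (∀ η : DiffForm (SU n) 3, IsThreeCurvature (basicProj n) (basicCurving n) η →
        (weyl n).pullback η = fun x => (-(1 / (2 * Real.pi * Complex.I))) •
          (∑ k, oneWedge ((p k x)⁻¹ • dp k x) (trPdPdP k k x)) + dbeta x) :=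
  ⟨isSmoothForm_beta n, isSmoothForm_pulledCurving n, pulledCurving_eq n, dBeta n,
    isExtDeriv_beta_iff, isThreeCurvature_pulledCurving_iff, fun _ h => pullback_weyl_eq h⟩
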